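/- Let $F$ be a field of characteristic $p>0$, let $(L,[p])$ be a finite-dimensional restricted Lie algebra over $F$, let $S\in L^*$ be a linear form, let $I$ be an ideal of $L$, and let $\lambda\in I^*$ be a linear form with $\lambda([y,z])=0$ for all $y,z\in I$. Put $$L^\lambda:=\{x\in L \mid \lambda([x,y])=0 \text{ for all } y\in I\},$$ which is a $p$-subalgebra of $L$ containing $I$. For a restricted Lie algebra $(G,[p])$ and $T\in G^*$, a $G$-module with representation $\rho$ is said to have character $T$ if $\rho(x)^p-\rho(x^{[p]})=T(x)^p\,\mathrm{id}$ for all $x\in G$; and $u(G,T)$ denotes the $T$-reduced universal enveloping algebra, i.e. the quotient of the universal enveloping algebra $U(G)$ by the two-sided ideal generated by all $x^p-x^{[p]}-T(x)^p\,1$, $x\in G$. Modules with character $T$ are the same as left $u(G,T)$-modules. Let $M$ be a finite-dimensional $L^\lambda$-module with character $S|_{L^\lambda}$ such that $y\cdot m=\lambda(y)m$ for all $y\in I$ and $m\in M$, and let $$\mathrm{Ind}_{L^\lambda}^L(M,S):=u(L,S)\otimes_{u(L^\lambda,\,S|_{L^\lambda})}M,$$ on which $L$ acts by left multiplication through the canonical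 map $L\to u(L,S)$. Then $\mathrm{Ind}_{L^\lambda}^L(M,S)$ is an irreducible $L$-module if and only if $M$ is an irreducible $L^\lambda$-module. (Irreducible modules are nonzero by definition.) -/

import Mathlib

open scoped TensorProduct

section ReducedEnveloping

attribute [local instance 100] LieRing.ofAssociativeRing

/-- `IsJacobsonFamily F p a b s` says that `s 1, …, s (p - 1)` are the elements `sᵢ(a, b)` of
Jacobson's formula: in `F[X] ⊗ L`,
`(ad (X ⊗ a + 1 ⊗ b)) ^ (p - 1) (1 ⊗ a) = ∑_{i = 1}^{p - 1} i X ^ (i - 1) ⊗ sᵢ(a, b)`. -/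
def IsJacobsonFamily (F : Type*) {L : Type*} [Field F] [LieRing L] [LieAlgebra F L]
    (p : ℕ) (a b : L) (s : ℕ → L) : Prop :=
  ((LieAlgebra.ad (Polynomial F) (Polynomial F ⊗[F] L)
      ((Polynomial.X : Polynomial F) ⊗ₜ[F] a + (1 : Polynomial F) ⊗ₜ[F] b)) ^ (p - 1))
      ((1 : Polynomial F) ⊗ₜ[F] a)
    = ∑ i ∈ Finset.Icc 1 (p - 1), i • ((Polynomial.X : Polynomial F) ^ (i - 1)) ⊗ₜ[F] s i

/-- A `p`-mapping `x ↦ x^[p]` on a Lie algebra `L` over a field `F` (of characteristic `p`);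
the pair `(L, [p])` is a restricted Lie algebra. -/
structure PMap (F L : Type*) (p : ℕ) [Field F] [LieRing L] [LieAlgebra F L] where
  /-- the mapping `x ↦ x^[p]` -/
  toFun : L → L
  ad_toFun : ∀ a : L, LieAlgebra.ad F L (toFun a) = (LieAlgebra.ad F L a) ^ p
  smul_toFun : ∀ (α : F) (a : L), toFun (α • a) = α ^ p • toFun a
  add_toFun : ∀ a b : L, ∃ s : ℕ → L, IsJacobsonFamily F p a b s ∧
    toFun (a + b) = toFun a + toFun b + ∑ i ∈ Finset.Icc 1 (p - 1), s i

instance {F L : Type*} {p : ℕ} [Field F] [LieRing L] [LieAlgebra F L] :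
    CoeFun (PMap F L p) (fun _ => L → L) := ⟨PMap.toFun⟩

variable {F L : Type*} {p : ℕ} [Field F] [LieRing L] [LieAlgebra F L]

/-- A subalgebra `H` is a `p`-subalgebra if `x^[p] ∈ H` for all `x ∈ H`. -/
def IsPSubalgebra (P : PMap F L p) (H : LieSubalgebra F L) : Prop :=
  ∀ x ∈ H, P x ∈ H

/-- The elements `sᵢ(a, b)` of a subalgebra are those of the ambient algebra. -/
theorem IsJacobsonFamily.exists_subalgebra [Fact p.Prime] [CharP F p] (H : LieSubalgebra F L)
    (a b : H) (s : ℕ → L) (hs : IsJacobsonFamily F p (a : L) (b : L) s) :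
    ∃ t : ℕ → H, IsJacobsonFamily F p a b t ∧ ∀ i ∈ Finset.Icc 1 (p - 1), (t i : L) = s i := by
  have hj : ∀ (n : ℕ) (v : Polynomial F ⊗[F] H),
      (H.toSubmodule.subtype.lTensor (Polynomial F))
        (((LieAlgebra.ad (Polynomial F) (Polynomial F ⊗[F] H)
          ((Polynomial.X : Polynomial F) ⊗ₜ[F] a + (1 : Polynomial F) ⊗ₜ[F] b)) ^ n) v)
      = ((LieAlgebra.ad (Polynomial F) (Polynomial F ⊗[F] L)
          ((Polynomial.X : Polynomial F) ⊗ₜ[F] (a : L) + (1 : Polynomial F) ⊗ₜ[F] (b : L))) ^ n)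
          ((H.toSubmodule.subtype.lTensor (Polynomial F)) v) := by
    intro n
    induction n with
    | zero => intro v; simp
    | succ n ih =>
      intro v
      rw [pow_succ, pow_succ, Module.End.mul_apply, Module.End.mul_apply, ih]
      congr 1
      induction v using TensorProduct.induction_on with
      | zero => simp
      | tmul f v => simp [LieAlgebra.ExtendScalars.bracket_tmul]
      | add v w hv hw => rw [map_add, map_add, hv, hw, ← map_add, ← map_add]
  have hinj : Function.Injective (H.toSubmodule.subtype.lTensor (Polynomial F)) :=
    Module.Flat.lTensor_preserves_injective_linearMap _ Subtype.val_injective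
  have hu := hj (p - 1) ((1 : Polynomial F) ⊗ₜ[F] a)
  have hs' : _ = _ := hs
  rw [LinearMap.lTensor_tmul] at hu
  change _ = ((LieAlgebra.ad (Polynomial F) (Polynomial F ⊗[F] L) _) ^ (p - 1))
    ((1 : Polynomial F) ⊗ₜ[F] (a : L)) at hu
  rw [hs'] at hu
  unfold IsJacobsonFamily
  generalize ((LieAlgebra.ad (Polynomial F) (Polynomial F ⊗[F] H)
          ((Polynomial.X : Polynomial F) ⊗ₜ[F] a + (1 : Polynomial F) ⊗ₜ[F] b)) ^ (p - 1))
          ((1 : Polynomial F) ⊗ₜ[F] a) = u at hu ⊢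
  have hcoeff : ∀ (k : ℕ) (v : Polynomial F ⊗[F] H),
      TensorProduct.lid F L ((Polynomial.lcoeff F k).rTensor L
        (H.toSubmodule.subtype.lTensor (Polynomial F) v))
      = ((TensorProduct.lid F H ((Polynomial.lcoeff F k).rTensor H v) : H) : L) := by
    intro k v
    induction v using TensorProduct.induction_on with
    | zero => simp
    | tmul f v => simp
    | add v w hv hw => simp only [map_add, hv, hw]; rfl
  have ht : ∀ i ∈ Finset.Icc 1 (p - 1), (((i : F)⁻¹ • TensorProduct.lid F H
      ((Polynomial.lcoeff F (i - 1)).rTensor H u) : H) : L) = s i := by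
    intro i hi
    obtain ⟨hi1, hi2⟩ := Finset.mem_Icc.mp hi
    have hp : 0 < p := (Fact.out : p.Prime).pos
    have hi0 : (i : F) ≠ 0 := by
      rw [Ne, CharP.cast_eq_zero_iff F p]
      exact fun h => absurd (Nat.le_of_dvd hi1 h) (by omega)
    change (i : F)⁻¹ • ((TensorProduct.lid F H
      ((Polynomial.lcoeff F (i - 1)).rTensor H u) : H) : L) = s i
    rw [← hcoeff, hu, map_sum, map_sum, Finset.sum_eq_single i]
    · simp [← Nat.cast_smul_eq_nsmul F, smul_smul, hi0]
    · intro j hj hji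
      have hne : j - 1 ≠ i - 1 := by
        have := (Finset.mem_Icc.mp hj).1
        omega
      simp [Polynomial.coeff_X_pow, Ne.symm hne]
    · exact fun h => absurd hi h
  refine ⟨_, hinj ?_, ht⟩
  rw [hu, map_sum]
  refine Finset.sum_congr rfl fun i hi => ?_
  rw [map_nsmul, LinearMap.lTensor_tmul, ← ht i hi]
  rfl

/-- A `p`-subalgebra is a restricted Lie algebra for the restriction of the `p`-mapping. -/
def PMap.restrict [Fact p.Prime] [CharP F p] (P : PMap F L p) (H : LieSubalgebra F L)
    (hH : IsPSubalgebra P H) : PMap F H p where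
  toFun x := ⟨P x, hH x x.2⟩
  ad_toFun a := by
    have key : ∀ (n : ℕ) (y : H), ((((LieAlgebra.ad F H a) ^ n) y : H) : L)
        = ((LieAlgebra.ad F L (a : L)) ^ n) y := by
      intro n
      induction n with
      | zero => intro y; simp
      | succ n ih =>
        intro y
        rw [pow_succ, pow_succ, Module.End.mul_apply, Module.End.mul_apply, ih]
        simp
    ext y
    rw [key, ← P.ad_toFun]
    simp
  smul_toFun α a := Subtype.ext (P.smul_toFun α a)
  add_toFun a b := by
    obtain ⟨s, hs, hadd⟩ := P.add_toFun (a : L) (b : L)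
    obtain ⟨t, ht, hts⟩ := hs.exists_subalgebra H a b
    refine ⟨t, ht, Subtype.ext ?_⟩
    have h : ((∑ i ∈ Finset.Icc 1 (p - 1), t i : H) : L) = ∑ i ∈ Finset.Icc 1 (p - 1), s i := by
      rw [← Finset.sum_congr rfl hts]
      exact map_sum H.toSubmodule.subtype _ _
    simp [hadd, h]

/-- The relations `x ^ p - x^[p] = S(x) ^ p 1` (`x ∈ L`) on the universal enveloping algebra. -/
inductive ReducedEnveloping.Rel (P : PMap F L p) (S : Module.Dual F L) :
    UniversalEnvelopingAlgebra F L → UniversalEnvelopingAlgebra F L → Prop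
  | of (x : L) : ReducedEnveloping.Rel P S
      (UniversalEnvelopingAlgebra.ι F x ^ p - UniversalEnvelopingAlgebra.ι F (P x))
      (algebraMap F (UniversalEnvelopingAlgebra F L) (S x ^ p))

/-- The `S`-reduced universal enveloping algebra `u(L, S)`: the quotient of `U(L)` by the two-sided
ideal generated by the elements `x ^ p - x^[p] - S(x) ^ p 1`. -/
abbrev ReducedEnveloping (P : PMap F L p) (S : Module.Dual F L) :=
  RingQuot (ReducedEnveloping.Rel P S)

namespace ReducedEnveloping

/-- The canonical map `L → u(L, S)`. -/
noncomputable def ι (P : PMap F L p) (S : Module.Dual F L) : L →ₗ⁅F⁆ ReducedEnveloping P S :=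
  (RingQuot.mkAlgHom F (Rel P S)).toLieHom.comp (UniversalEnvelopingAlgebra.ι F)

theorem ι_pow_sub (P : PMap F L p) (S : Module.Dual F L) (x : L) :
    ι P S x ^ p - ι P S (P x) = algebraMap F (ReducedEnveloping P S) (S x ^ p) := by
  have h := RingQuot.mkAlgHom_rel F (Rel.of (P := P) (S := S) x)
  rw [map_sub, map_pow, AlgHom.commutes] at h
  exact h

/-- The universal property of `u(L, S)`: existence. -/
noncomputable def lift (P : PMap F L p) (S : Module.Dual F L) {A : Type*} [Ring A] [Algebra F A]
    (f : L →ₗ⁅F⁆ A) (hf : ∀ x, f x ^ p - f (P x) = algebraMap F A (S x ^ p)) :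
    ReducedEnveloping P S →ₐ[F] A :=
  RingQuot.liftAlgHom F ⟨UniversalEnvelopingAlgebra.lift F f, by
    rintro _ _ ⟨x⟩
    rw [map_sub, map_pow, AlgHom.commutes, UniversalEnvelopingAlgebra.lift_ι_apply,
      UniversalEnvelopingAlgebra.lift_ι_apply, hf]⟩

theorem lift_ι (P : PMap F L p) (S : Module.Dual F L) {A : Type*} [Ring A] [Algebra F A]
    (f : L →ₗ⁅F⁆ A) (hf : ∀ x, f x ^ p - f (P x) = algebraMap F A (S x ^ p)) (x : L) :
    lift P S f hf (ι P S x) = f x := by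
  have h : lift P S f hf (RingQuot.mkAlgHom F (Rel P S) (UniversalEnvelopingAlgebra.ι F x))
      = UniversalEnvelopingAlgebra.lift F f (UniversalEnvelopingAlgebra.ι F x) :=
    RingQuot.liftAlgHom_mkAlgHom_apply _ _ _ _
  rw [UniversalEnvelopingAlgebra.lift_ι_apply] at h
  exact h

/-- The universal property of `u(L, S)`: uniqueness. -/
theorem hom_ext {P : PMap F L p} {S : Module.Dual F L} {A : Type*} [Ring A] [Algebra F A]
    {f g : ReducedEnveloping P S →ₐ[F] A} (h : ∀ x, f (ι P S x) = g (ι P S x)) : f = g := by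
  refine RingQuot.ringQuot_ext' F f g (UniversalEnvelopingAlgebra.hom_ext F ?_)
  ext x
  exact h x

end ReducedEnveloping

/-- The `L`-module `V` has character `S`, i.e. the corresponding representation `ρ` satisfies
`ρ(x) ^ p - ρ(x^[p]) = S(x) ^ p id` for all `x ∈ L`. -/
def HasCharacter (P : PMap F L p) (S : Module.Dual F L) (V : Type*) [AddCommGroup V] [Module F V]
    [LieRingModule L V] [LieModule F L V] : Prop :=
  ∀ x : L, LieModule.toEnd F L V x ^ p - LieModule.toEnd F L V (P x)
    = (S x ^ p) • (1 : Module.End F V)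

/-- The action `u(L, S) → End V` on an `L`-module `V` with character `S`. -/
noncomputable def HasCharacter.action {P : PMap F L p} {S : Module.Dual F L} {V : Type*}
    [AddCommGroup V] [Module F V] [LieRingModule L V] [LieModule F L V]
    (hV : HasCharacter P S V) : ReducedEnveloping P S →ₐ[F] Module.End F V :=
  ReducedEnveloping.lift P S (LieModule.toEnd F L V)
    (fun x => by rw [hV x, Algebra.algebraMap_eq_smul_one])

section Induced

variable [Fact p.Prime] [CharP F p] (P : PMap F L p) (S : Module.Dual F L)
  (H : LieSubalgebra F L) (hH : IsPSubalgebra P H)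

/-- The restriction `S|_H` of a linear form to a subalgebra. -/
abbrev restrictDual (S : Module.Dual F L) (H : LieSubalgebra F L) : Module.Dual F H :=
  S ∘ₗ H.toSubmodule.subtype

/-- The canonical homomorphism `u(H, S|_H) → u(L, S)` extending the inclusion of `H` in `L`. -/
noncomputable def ReducedEnveloping.incl :
    ReducedEnveloping (P.restrict H hH) (restrictDual S H) →ₐ[F] ReducedEnveloping P S :=
  ReducedEnveloping.lift _ _ ((ReducedEnveloping.ι P S).comp H.incl)
    (fun x => ReducedEnveloping.ι_pow_sub P S (x : L))

variable {P S H hH}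
variable {M : Type*} [AddCommGroup M] [Module F M] [LieRingModule H M] [LieModule F H M]
  (hM : HasCharacter (P.restrict H hH) (restrictDual S H) M)

/-- The submodule of `u(L, S) ⊗_F M` generated by the elements `a b ⊗ m - a ⊗ b m` with
`a ∈ u(L, S)`, `b ∈ u(H, S|_H)` and `m ∈ M`. As this set of generators is stable under left
multiplication by `u(L, S)`, its `F`-span is the same. -/
noncomputable def balancedSubmodule :
    Submodule (ReducedEnveloping P S) (ReducedEnveloping P S ⊗[F] M) :=
  Submodule.span _ {t | ∃ (a : ReducedEnveloping P S)
    (b : ReducedEnveloping (P.restrict H hH) (restrictDual S H)) (m : M),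
    t = (a * ReducedEnveloping.incl P S H hH b) ⊗ₜ[F] m - a ⊗ₜ[F] (hM.action b m)}

/-- The induced module `Ind_H^L(M, S) = u(L, S) ⊗_{u(H, S|_H)} M`. -/
abbrev Ind := (ReducedEnveloping P S ⊗[F] M) ⧸ balancedSubmodule hM

/-- `L` acts on `Ind_H^L(M, S)` by left multiplication through `L → u(L, S)`. -/
noncomputable instance Ind.instLieRingModule : LieRingModule L (Ind hM) where
  bracket x v := ReducedEnveloping.ι P S x • v
  add_lie x y v := by
    change ReducedEnveloping.ι P S (x + y) • v = _ • v + _ • v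
    rw [map_add, add_smul]
  lie_add x v w := smul_add _ v w
  leibniz_lie x y v := by
    change _ • _ • v = ReducedEnveloping.ι P S ⁅x, y⁆ • v + _ • _ • v
    rw [LieHom.map_lie, LieRing.of_associative_ring_bracket, sub_smul, mul_smul, mul_smul,
      sub_add_cancel]

theorem Ind.lie_def (x : L) (v : Ind hM) : ⁅x, v⁆ = ReducedEnveloping.ι P S x • v := rfl

instance Ind.instLieModule : LieModule F L (Ind hM) where
  smul_lie c x v := by rw [Ind.lie_def, Ind.lie_def, map_smul, smul_assoc]
  lie_smul c x v := by rw [Ind.lie_def, Ind.lie_def, smul_comm]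

end Induced

section Stabilizer

variable (I : LieIdeal F L) (lam : Module.Dual F I)

/-- `L^λ = {x ∈ L | λ([x, y]) = 0 for all y ∈ I}`, for an ideal `I` of `L` and `λ ∈ I^*`. -/
def lieStabilizer : LieSubalgebra F L where
  carrier := {x | ∀ y : I, lam ⁅x, y⁆ = 0}
  add_mem' := fun {a b} ha hb y => by
    have ha := ha y
    have hb := hb y
    rw [add_lie, map_add, ha, hb, add_zero]
  zero_mem' := fun y => by rw [zero_lie, map_zero]
  smul_mem' := fun c x hx y => by
    have hx := hx y
    rw [smul_lie, map_smul, hx, smul_zero]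
  lie_mem' := fun {a b} ha hb y => by
    rw [lie_lie, map_sub, ha, hb, sub_zero]

theorem mem_lieStabilizer (x : L) : x ∈ lieStabilizer I lam ↔ ∀ y : I, lam ⁅x, y⁆ = 0 := Iff.rfl

/-- `L^λ` is a `p`-subalgebra. -/
theorem isPSubalgebra_lieStabilizer [Fact p.Prime] (P : PMap F L p) :
    IsPSubalgebra P (lieStabilizer I lam) := by
  have key : ∀ (n : ℕ) (x : L) (y : I),
      ((((LieModule.toEnd F L I x) ^ n) y : I) : L) = ((LieAlgebra.ad F L x) ^ n) y := by
    intro n x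
    induction n with
    | zero => intro y; simp
    | succ n ih =>
      intro y
      rw [pow_succ, pow_succ, Module.End.mul_apply, Module.End.mul_apply, ih]
      simp
  intro x hx y
  have hp : p = (p - 1) + 1 := (Nat.succ_pred_prime Fact.out).symm
  have h : ⁅P x, y⁆ = ⁅x, ((LieModule.toEnd F L I x) ^ (p - 1)) y⁆ := by
    apply Subtype.ext
    have h1 := key p x y
    rw [← P.ad_toFun] at h1
    have h2 : (LieModule.toEnd F L I x) ^ p
        = LieModule.toEnd F L I x * (LieModule.toEnd F L I x) ^ (p - 1) := by
      rw [← pow_succ', ← hp]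
    rw [h2, Module.End.mul_apply] at h1
    simpa using h1.symm
  rw [h]
  exact hx _

/-- If `λ` vanishes on `I^(1) = [I, I]` then `I ⊆ L^λ`. -/
theorem mem_lieStabilizer_of_mem (hlam : ∀ y z : I, lam ⁅y, z⁆ = 0) (y : I) :
    (y : L) ∈ lieStabilizer I lam := fun z => hlam y z

end Stabilizer

end ReducedEnveloping

/-! ### Relative PBW: the action of L on monomials with coefficients in M. -/

section RelativePBW

attribute [local instance 100] LieRing.ofAssociativeRing

/-! Write H for L^λ. Choose y_1, …, y_k in I such that the forms x ↦ λ([x, y_i]) are a basis of the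
space R of all forms x ↦ λ([x, y]) with y ∈ I, and choose e_1, …, e_k in L dual to them. Since H is
the common kernel of R, the e_i span a complement of H, with coordinates λ([x, y_i])
(`exists_complBasis_lieStabilizer`).

The induced module is spanned by products e^a ⊗ m with all exponents below p. For y ∈ I the operator
y - λ(y) kills 1 ⊗ M and lowers the degree, and y_j - λ(y_j) acts as -∂/∂e_j up to terms of lower
degree (`shiftedRep_single_add_mem`). Positive exponents below p are invertible in F, so these
operators take a suitable nonzero vector of an L-submodule W down to some 1 ⊗ m in W with m ≠ 0
(`exists_single_zero_mem`). If M is irreducible, then W contains 1 ⊗ M, which generates everything.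

Conversely, an H-submodule N of M is recovered from the L-submodule it generates, because M/N embeds
in a reduced induced module of its own (`Ind.mem_of_of_mem_lieSpan`). So a proper nonzero N would
generate a proper nonzero L-submodule. This half works for any p-subalgebra with a `ComplBasis`.

Both halves rest on an explicit model. On `Multiset ι →₀ M`, where `single s m` stands for the
ordered product of the e_i, i ∈ s, applied to m, straightening defines an action of L (`actsAsLie`).
The operators z_i = e_i^p - e_i^[p] - S(e_i)^p commute with L and have leading term e_i^p. A
unitriangular change of basis (`normalize_bijective`) turns multiplication by e_i^p into z_i, so M
survives in the quotient by the images of the z_i. This quotient has character S since x^p - x^[p] -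
S(x)^p is p-semilinear in x, by Jacobson's formula. -/

/-- A basis of a vector space complement of the subalgebra `H` of `L`, with the coordinate
functions and the projection to `H`. -/
structure LieSubalgebra.ComplBasis {F L : Type*} [Field F] [LieRing L] [LieAlgebra F L]
    (H : LieSubalgebra F L) (ι : Type*) [Fintype ι] [DecidableEq ι] where
  vec : ι → L
  coord : ι → Module.Dual F L
  proj : L →ₗ[F] H
  decomp : ∀ x, ∑ i, coord i x • vec i + (proj x : L) = x
  coord_vec : ∀ i j, coord i (vec j) = if i = j then 1 else 0
  coord_coe : ∀ i (h : H), coord i (h : L) = 0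

/-- Splits the leftmost factor off an ordered monomial. The pair is packed into one existential so
that a single choice provides both parts in the recursion for `rem`. -/
theorem Multiset.exists_eq_cons_forall_le {ι : Type*} [LinearOrder ι] (s : Multiset ι)
    (hs : s ≠ 0) : ∃ q : ι × Multiset ι, s = q.1 ::ₘ q.2 ∧ ∀ i ∈ q.2, q.1 ≤ i := by
  have hne : s.toFinset.Nonempty := by
    rw [Finset.nonempty_iff_ne_empty, Ne, Multiset.toFinset_eq_empty]
    exact hs
  refine ⟨(s.toFinset.min' hne, s.erase (s.toFinset.min' hne)), ?_, ?_⟩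
  · exact (Multiset.cons_erase (Multiset.mem_toFinset.mp (s.toFinset.min'_mem hne))).symm
  · exact fun i hi => s.toFinset.min'_le i (Multiset.mem_toFinset.mpr (Multiset.mem_of_mem_erase hi))

theorem Multiset.cons_inj_of_forall_le {ι : Type*} [LinearOrder ι] {i j : ι} {s t : Multiset ι}
    (h : i ::ₘ s = j ::ₘ t) (hs : ∀ k ∈ s, i ≤ k) (ht : ∀ k ∈ t, j ≤ k) : i = j ∧ s = t := by
  have hij : i = j := by
    refine le_antisymm ?_ ?_
    · have : j ∈ i ::ₘ s := h ▸ Multiset.mem_cons_self j t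
      rcases Multiset.mem_cons.mp this with h1 | h1
      · exact h1.ge
      · exact hs _ h1
    · have : i ∈ j ::ₘ t := h ▸ Multiset.mem_cons_self i s
      rcases Multiset.mem_cons.mp this with h1 | h1
      · exact h1.ge
      · exact ht _ h1
  subst hij
  exact ⟨rfl, (Multiset.cons_inj_right i).mp h⟩

namespace Finsupp

variable (F : Type*) [Semiring F] {ι M : Type*} [AddCommMonoid M] [Module F M]

/-- Combinations of monomials of degree less than `d`. -/
noncomputable def degreeLT (d : ℕ) : Submodule F (Multiset ι →₀ M) :=
  Finsupp.supported M F {s | Multiset.card s < d}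

variable {F}

theorem single_mem_degreeLT {d : ℕ} {s : Multiset ι} (h : Multiset.card s < d) (m : M) :
    single s m ∈ degreeLT F d :=
  Finsupp.single_mem_supported F m h

theorem degreeLT_mono {d e : ℕ} (h : d ≤ e) :
    degreeLT F (ι := ι) (M := M) d ≤ degreeLT F e :=
  Finsupp.supported_mono fun _ hs => lt_of_lt_of_le hs h

theorem eq_zero_of_mem_degreeLT_zero {v : Multiset ι →₀ M} (h : v ∈ degreeLT F 0) : v = 0 := by
  have h0 : (v.support : Set (Multiset ι)) ⊆ _ := h
  ext s
  by_contra hs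
  exact absurd (h0 (Finsupp.mem_support_iff.mpr hs)) (by simp)

theorem apply_eq_zero_of_mem_degreeLT {d : ℕ} {v : Multiset ι →₀ M} (h : v ∈ degreeLT F d)
    {s : Multiset ι} (hs : d ≤ Multiset.card s) : v s = 0 := by
  have h0 : (v.support : Set (Multiset ι)) ⊆ _ := h
  by_contra hv
  exact absurd (h0 (Finsupp.mem_support_iff.mpr hv)) (by simpa using hs)

theorem exists_mem_degreeLT (v : Multiset ι →₀ M) : ∃ d, v ∈ degreeLT F d := by
  refine ⟨v.support.sup Multiset.card + 1, ?_⟩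
  intro s hs
  exact Nat.lt_succ_of_le (Finset.le_sup (f := Multiset.card) hs)

theorem map_mem_of_mem_degreeLT {W : Type*} [AddCommMonoid W] [Module F W]
    (f : (Multiset ι →₀ M) →ₗ[F] W) (N : Submodule F W) {d : ℕ}
    (hf : ∀ s m, Multiset.card s < d → f (single s m) ∈ N) {v : Multiset ι →₀ M}
    (hv : v ∈ degreeLT F d) : f v ∈ N := by
  rw [← Finsupp.sum_single v, Finsupp.sum, map_sum]
  exact N.sum_mem fun s hs => hf s _ (hv hs)

theorem map_eq_of_mem_degreeLT {W : Type*} [AddCommMonoid W] [Module F W]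
    (f g : (Multiset ι →₀ M) →ₗ[F] W) {d : ℕ}
    (hf : ∀ s m, Multiset.card s < d → f (single s m) = g (single s m)) {v : Multiset ι →₀ M}
    (hv : v ∈ degreeLT F d) : f v = g v := by
  rw [← Finsupp.sum_single v, Finsupp.sum, map_sum, map_sum]
  exact Finset.sum_congr rfl fun s hs => hf s _ (hv hs)

end Finsupp

namespace LieSubalgebra.ComplBasis

open Finsupp

variable {F L M ι : Type*} [Field F] [LieRing L] [LieAlgebra F L] {H : LieSubalgebra F L}
  [Fintype ι] [LinearOrder ι] (B : H.ComplBasis ι)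

@[simp] theorem proj_vec (j : ι) : B.proj (B.vec j) = 0 := by
  have h := B.decomp (B.vec j)
  simp only [B.coord_vec, ite_smul, one_smul, zero_smul, Finset.sum_ite_eq', Finset.mem_univ,
    if_true] at h
  simpa using h

@[simp] theorem proj_coe (h : H) : B.proj (h : L) = h := by
  have h1 := B.decomp (h : L)
  simp only [B.coord_coe, zero_smul, Finset.sum_const_zero, zero_add] at h1
  exact Subtype.ext h1

/-- Drop the coordinates `≤ j`. -/
noncomputable def tail (j : ι) : L →ₗ[F] L :=
  LinearMap.id - ∑ i ∈ Finset.univ.filter (· ≤ j), (B.coord i).smulRight (B.vec i)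

theorem tail_apply (j : ι) (x : L) :
    B.tail j x = x - ∑ i ∈ Finset.univ.filter (· ≤ j), B.coord i x • B.vec i := by
  simp [tail]

theorem tail_vec_of_le {i j : ι} (h : i ≤ j) : B.tail j (B.vec i) = 0 := by
  simp [tail_apply, B.coord_vec, h]

theorem tail_vec_of_lt {i j : ι} (h : j < i) : B.tail j (B.vec i) = B.vec i := by
  simp [tail_apply, B.coord_vec, h]

theorem tail_coe (j : ι) (h : H) : B.tail j (h : L) = h := by
  simp [tail_apply, B.coord_coe]

theorem coord_tail_of_le {i j : ι} (h : i ≤ j) (x : L) : B.coord i (B.tail j x) = 0 := by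
  simp [tail_apply, B.coord_vec, h]

theorem induction_on {C : L → Prop} (hvec : ∀ i, C (B.vec i)) (hcoe : ∀ h : H, C h)
    (hadd : ∀ x y, C x → C y → C (x + y)) (hsmul : ∀ (a : F) x, C x → C (a • x)) (x : L) : C x := by
  rw [← B.decomp x]
  refine hadd _ _ ?_ (hcoe _)
  refine Finset.sum_induction _ C hadd ?_ fun i _ => hsmul _ _ (hvec i)
  simpa using hcoe 0

variable [AddCommGroup M] [Module F M]

variable (F M) in
/-- Multiplication of monomials by the variable `i`. -/
noncomputable def shift (i : ι) : (Multiset ι →₀ M) →ₗ[F] (Multiset ι →₀ M) :=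
  Finsupp.lmapDomain M F (Multiset.cons i)

@[simp] theorem shift_single (i : ι) (s : Multiset ι) (m : M) :
    shift F M i (single s m) = single (i ::ₘ s) m := by
  simp [shift]

theorem shift_mem (i : ι) {d : ℕ} {v : Multiset ι →₀ M} (hv : v ∈ degreeLT F d) :
    shift F M i v ∈ degreeLT F (d + 1) :=
  map_mem_of_mem_degreeLT _ _ (fun s m hs => by
    rw [shift_single]
    exact single_mem_degreeLT (by simpa using hs) m) hv

variable (M) in
/-- The leading part of the action of `L`. -/
noncomputable def lead : (Multiset ι →₀ M) →ₗ[F] L →ₗ[F] (Multiset ι →₀ M) :=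
  LinearMap.mk₂ F (fun v x => ∑ i, B.coord i x • shift F M i v)
    (fun v w x => by simp [Finset.sum_add_distrib])
    (fun c v x => by simp [Finset.smul_sum, smul_comm c])
    (fun v x y => by simp [add_smul, Finset.sum_add_distrib])
    (fun c v x => by simp [Finset.smul_sum, mul_smul])

theorem lead_apply (v : Multiset ι →₀ M) (x : L) :
    B.lead M v x = ∑ i, B.coord i x • shift F M i v := rfl

theorem lead_vec (v : Multiset ι →₀ M) (i : ι) : B.lead M v (B.vec i) = shift F M i v := by
  simp [lead_apply, B.coord_vec]

theorem lead_coe (v : Multiset ι →₀ M) (h : H) : B.lead M v (h : L) = 0 := by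
  simp [lead_apply, B.coord_coe]

theorem lead_mem {d : ℕ} {v : Multiset ι →₀ M} (hv : v ∈ degreeLT F d) (x : L) :
    B.lead M v x ∈ degreeLT F (d + 1) :=
  Submodule.sum_mem _ fun i _ => Submodule.smul_mem _ _ (shift_mem i hv)

variable [LieRingModule H M] [LieModule F H M]

variable (M) in
/-- The action of `L` on monomials of degree zero, up to the leading part. -/
noncomputable def base : M →ₗ[F] L →ₗ[F] (Multiset ι →₀ M) :=
  LinearMap.mk₂ F (fun m x => single 0 ⁅B.proj x, m⁆)
    (fun v w x => by simp) (fun c v x => by simp)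
    (fun v x y => by simp) (fun c v x => by simp)

/-- The recursive step in the definition of the action of `L`. -/
noncomputable def step (R : (Multiset ι →₀ M) →ₗ[F] L →ₗ[F] (Multiset ι →₀ M)) (j : ι)
    (t : Multiset ι) : M →ₗ[F] L →ₗ[F] (Multiset ι →₀ M) :=
  LinearMap.mk₂ F (fun m x => (B.lead M + R) (R (single t m) (B.tail j x)) (B.vec j)
      + (B.lead M + R) (single t m) ⁅B.tail j x, B.vec j⁆)
    (fun v w x => by
      simp only [single_add, map_add, LinearMap.add_apply]
      abel)
    (fun c v x => by simp only [← smul_single, map_smul, LinearMap.smul_apply, smul_add])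
    (fun v x y => by
      simp only [map_add, LinearMap.add_apply, add_lie]
      abel)
    (fun c v x => by simp only [map_smul, LinearMap.smul_apply, smul_add, smul_lie])

open Classical in
variable (M) in
/-- The action of `L` up to the leading part, on monomials of degree at most `n`. -/
noncomputable def rem : ℕ → (Multiset ι →₀ M) →ₗ[F] L →ₗ[F] (Multiset ι →₀ M)
  | 0 => Finsupp.lsum F fun s => if s = 0 then B.base M else 0
  | n + 1 => Finsupp.lsum F fun s => if h : s = 0 then B.base M else
      B.step (rem n) (s.exists_eq_cons_forall_le h).choose.1
        (s.exists_eq_cons_forall_le h).choose.2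

theorem rem_single_zero (n : ℕ) (m : M) (x : L) :
    B.rem M n (single 0 m) x = single 0 ⁅B.proj x, m⁆ := by
  cases n <;> simp [rem, base]

theorem rem_succ_single_cons (n : ℕ) {j : ι} {t : Multiset ι} (ht : ∀ i ∈ t, j ≤ i) (m : M)
    (x : L) : B.rem M (n + 1) (single (j ::ₘ t) m) x
      = (B.lead M + B.rem M n) (B.rem M n (single t m) (B.tail j x)) (B.vec j)
      + (B.lead M + B.rem M n) (single t m) ⁅B.tail j x, B.vec j⁆ := by
  have h : j ::ₘ t ≠ 0 := Multiset.cons_ne_zero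
  have hc := (Multiset.exists_eq_cons_forall_le _ h).choose_spec
  -- The least element and the rest are unique, so the pair chosen in `rem` is (j, t).
  obtain ⟨h1, h2⟩ := Multiset.cons_inj_of_forall_le hc.1 ht hc.2
  simp only [rem, Finsupp.lsum_single, dif_neg h]
  rw [← h1, ← h2]
  rfl

theorem rem_mem (n : ℕ) {d : ℕ} {v : Multiset ι →₀ M} (hv : v ∈ degreeLT F d) (x : L) :
    B.rem M n v x ∈ degreeLT F d := by
  induction n generalizing d v x with
  | zero =>
    refine map_mem_of_mem_degreeLT ((B.rem M 0).flip x) _ (fun s m hs => ?_) hv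
    by_cases h : s = 0
    · subst h
      rw [LinearMap.flip_apply, rem_single_zero]
      exact single_mem_degreeLT hs _
    · simp [rem, h]
  | succ n ih =>
    refine map_mem_of_mem_degreeLT ((B.rem M (n + 1)).flip x) _ (fun s m hs => ?_) hv
    rw [LinearMap.flip_apply]
    by_cases h : s = 0
    · subst h
      rw [rem_single_zero]
      exact single_mem_degreeLT hs _
    · obtain ⟨⟨j, t⟩, rfl, ht⟩ := s.exists_eq_cons_forall_le h
      rw [rem_succ_single_cons _ _ ht]
      obtain ⟨d, rfl⟩ : ∃ e, d = e + 1 := ⟨d - 1, by omega⟩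
      have hs' : Multiset.card t < d := by simpa using hs
      have hs1 := single_mem_degreeLT (F := F) hs' m
      have key : ∀ w ∈ degreeLT F d, ∀ y, (B.lead M + B.rem M n) w y ∈ degreeLT F (d + 1) :=
        fun w hw y => Submodule.add_mem _ (B.lead_mem hw y)
          (degreeLT_mono (Nat.le_succ d) (ih hw y))
      exact Submodule.add_mem _ (key _ (ih hs1 _) _) (key _ hs1 _)

/-- The index only bounds the depth of the recursion. A monomial of degree at most n never reaches
the bottom early, because `rem` does not raise degrees. -/
theorem rem_succ_eq (n : ℕ) {v : Multiset ι →₀ M} (hv : v ∈ degreeLT F (n + 1)) (x : L) :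
    B.rem M (n + 1) v x = B.rem M n v x := by
  induction n generalizing v x with
  | zero =>
    refine map_eq_of_mem_degreeLT ((B.rem M 1).flip x) ((B.rem M 0).flip x) (fun s m hs => ?_) hv
    obtain rfl : s = 0 := by simpa using hs
    simp only [LinearMap.flip_apply, rem_single_zero]
  | succ n ih =>
    refine map_eq_of_mem_degreeLT ((B.rem M (n + 2)).flip x) ((B.rem M (n + 1)).flip x)
      (fun s m hs => ?_) hv
    simp only [LinearMap.flip_apply]
    by_cases h : s = 0
    · subst h
      simp only [rem_single_zero]
    · obtain ⟨⟨j, t⟩, rfl, ht⟩ := s.exists_eq_cons_forall_le h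
      have hs1 := single_mem_degreeLT (F := F) (show Multiset.card t < n + 1 by simpa using hs) m
      rw [rem_succ_single_cons _ _ ht, rem_succ_single_cons _ _ ht]
      simp only [LinearMap.add_apply]
      rw [ih hs1, ih hs1, ih (B.rem_mem n hs1 _)]

theorem rem_eq_of_le {n k : ℕ} (h : n ≤ k) {v : Multiset ι →₀ M} (hv : v ∈ degreeLT F (n + 1))
    (x : L) : B.rem M k v x = B.rem M n v x := by
  induction k, h using Nat.le_induction with
  | base => rfl
  | succ k hk ih => rw [B.rem_succ_eq k (degreeLT_mono (by omega) hv), ih]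

variable (M) in
/-- The action of `L` on the induced module, up to the leading part. -/
noncomputable def lower : (Multiset ι →₀ M) →ₗ[F] L →ₗ[F] (Multiset ι →₀ M) :=
  Finsupp.lsum F fun s => (B.rem M (Multiset.card s)).comp (Finsupp.lsingle s)

theorem lower_eq_rem {n : ℕ} {v : Multiset ι →₀ M} (hv : v ∈ degreeLT F (n + 1)) (x : L) :
    B.lower M v x = B.rem M n v x := by
  refine map_eq_of_mem_degreeLT ((B.lower M).flip x) ((B.rem M n).flip x) (fun s m hs => ?_) hv
  simp only [LinearMap.flip_apply, lower, Finsupp.lsum_single, LinearMap.comp_apply,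
    Finsupp.lsingle_apply]
  exact (B.rem_eq_of_le (Nat.lt_succ_iff.mp hs)
    (single_mem_degreeLT (Nat.lt_succ_self _) m) x).symm

theorem lower_mem {d : ℕ} {v : Multiset ι →₀ M} (hv : v ∈ degreeLT F d) (x : L) :
    B.lower M v x ∈ degreeLT F d := by
  rw [B.lower_eq_rem (degreeLT_mono (Nat.le_succ d) hv)]
  exact B.rem_mem d hv x

variable (M) in
/-- The action of `L` on the induced module. -/
noncomputable def act : (Multiset ι →₀ M) →ₗ[F] L →ₗ[F] (Multiset ι →₀ M) := B.lead M + B.lower M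

theorem act_apply (v : Multiset ι →₀ M) (x : L) :
    B.act M v x = B.lead M v x + B.lower M v x := rfl

theorem act_mem {d : ℕ} {v : Multiset ι →₀ M} (hv : v ∈ degreeLT F d) (x : L) :
    B.act M v x ∈ degreeLT F (d + 1) :=
  Submodule.add_mem _ (B.lead_mem hv x) (degreeLT_mono (Nat.le_succ d) (B.lower_mem hv x))

theorem lower_single_zero (m : M) (x : L) :
    B.lower M (single 0 m) x = single 0 ⁅B.proj x, m⁆ := by
  rw [B.lower_eq_rem (n := 0) (single_mem_degreeLT (by simp) m), rem_single_zero]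

/-- This is the rule x e_j = e_j x + [x, e_j] without its leading part. Coordinates of x up to j
drop out, since e_i e_j t is already ordered when i ≤ j. -/
theorem lower_single_cons {j : ι} {t : Multiset ι} (ht : ∀ i ∈ t, j ≤ i) (m : M) (x : L) :
    B.lower M (single (j ::ₘ t) m) x
      = B.act M (B.lower M (single t m) (B.tail j x)) (B.vec j)
      + B.act M (single t m) ⁅B.tail j x, B.vec j⁆ := by
  have h1 : single (j ::ₘ t) m ∈ degreeLT F (Multiset.card t + 1 + 1) :=
    single_mem_degreeLT (by simp) m
  have h2 : single t m ∈ degreeLT F (Multiset.card t + 1) := single_mem_degreeLT (by simp) m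
  rw [B.lower_eq_rem h1, rem_succ_single_cons _ _ ht]
  simp only [act_apply, LinearMap.add_apply]
  rw [B.lower_eq_rem h2, B.lower_eq_rem h2, B.lower_eq_rem (B.rem_mem _ h2 _)]

theorem act_coe_single_zero (h : H) (m : M) :
    B.act M (single 0 m) (h : L) = single 0 ⁅h, m⁆ := by
  simp [act_apply, lead_coe, lower_single_zero]

theorem act_vec_single {i : ι} {s : Multiset ι} (hs : ∀ k ∈ s, i ≤ k) (m : M) :
    B.act M (single s m) (B.vec i) = single (i ::ₘ s) m := by
  rw [act_apply, lead_vec, shift_single]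
  by_cases h : s = 0
  · subst h
    simp [lower_single_zero]
  · obtain ⟨⟨j, t⟩, rfl, ht⟩ := s.exists_eq_cons_forall_le h
    rw [lower_single_cons _ ht, B.tail_vec_of_le (hs j (by simp))]
    simp

theorem act_single_cons_of_tail_eq {j : ι} {t : Multiset ι} (ht : ∀ i ∈ t, j ≤ i) (m : M) {x : L}
    (hx : B.tail j x = x) :
    B.act M (single (j ::ₘ t) m) x
      = B.act M (B.act M (single t m) x) (B.vec j) + B.act M (single t m) ⁅x, B.vec j⁆ := by
  -- Only indices i > j occur in x, so j is still least in `j ::ₘ i ::ₘ t` and e_j is simply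
  -- prepended.
  have h : B.act M (B.lead M (single t m) x) (B.vec j) = B.lead M (single (j ::ₘ t) m) x := by
    simp only [lead_apply, map_sum, map_smul, LinearMap.sum_apply, LinearMap.smul_apply,
      shift_single]
    refine Finset.sum_congr rfl fun i _ => ?_
    by_cases hij : i ≤ j
    · have := B.coord_tail_of_le hij x
      rw [hx] at this
      simp [this]
    · rw [B.act_vec_single, Multiset.cons_swap]
      intro k hk
      rcases Multiset.mem_cons.mp hk with rfl | hk
      · exact (not_le.mp hij).le
      · exact ht _ hk
  rw [act_apply, lower_single_cons _ ht, hx, ← h, B.act_apply (single t m) x, map_add,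
    LinearMap.add_apply, add_assoc]

end LieSubalgebra.ComplBasis

end RelativePBW

/-! ### Relative PBW: the action respects brackets. -/

section RelativePBW

attribute [local instance 100] LieRing.ofAssociativeRing

namespace LieSubalgebra.ComplBasis

open Finsupp

variable {F L M ι : Type*} [Field F] [LieRing L] [LieAlgebra F L] {H : LieSubalgebra F L}
  [Fintype ι] [LinearOrder ι] (B : H.ComplBasis ι) [AddCommGroup M] [Module F M]
  [LieRingModule H M] [LieModule F H M]

/-- The identity `x (y v) = y (x v) + [x, y] v`. -/
def ActsAsLie (x y : L) (v : Multiset ι →₀ M) : Prop :=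
  B.act M (B.act M v y) x = B.act M (B.act M v x) y + B.act M v ⁅x, y⁆

variable {B}

theorem ActsAsLie.symm {x y : L} {v : Multiset ι →₀ M} (h : B.ActsAsLie x y v) :
    B.ActsAsLie y x v := by
  unfold ActsAsLie at *
  rw [h, ← lie_skew x y, map_neg, neg_add_cancel_right]

theorem ActsAsLie.add_left {x x' y : L} {v : Multiset ι →₀ M} (h : B.ActsAsLie x y v)
    (h' : B.ActsAsLie x' y v) : B.ActsAsLie (x + x') y v := by
  unfold ActsAsLie at *
  simp only [map_add, add_lie, h, h', LinearMap.add_apply]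
  abel

theorem ActsAsLie.smul_left {x y : L} {v : Multiset ι →₀ M} (a : F) (h : B.ActsAsLie x y v) :
    B.ActsAsLie (a • x) y v := by
  unfold ActsAsLie at *
  simp only [map_smul, smul_lie, h, smul_add, LinearMap.smul_apply]

theorem ActsAsLie.add {x y : L} {v w : Multiset ι →₀ M} (h : B.ActsAsLie x y v)
    (h' : B.ActsAsLie x y w) : B.ActsAsLie x y (v + w) := by
  unfold ActsAsLie at *
  simp only [map_add, h, h', LinearMap.add_apply]
  abel

variable (B)

theorem actsAsLie_self (x : L) (v : Multiset ι →₀ M) : B.ActsAsLie x x v := by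
  simp [ActsAsLie]

theorem actsAsLie_of_degreeLT {d : ℕ} {x y : L}
    (h : ∀ s (m : M), Multiset.card s < d → B.ActsAsLie x y (single s m)) {v : Multiset ι →₀ M}
    (hv : v ∈ degreeLT F d) : B.ActsAsLie x y v :=
  map_eq_of_mem_degreeLT (((B.act M).flip x).comp ((B.act M).flip y))
    (((B.act M).flip y).comp ((B.act M).flip x) + (B.act M).flip ⁅x, y⁆) h hv

theorem actsAsLie_vec_of_tail_eq {j : ι} {t : Multiset ι} (ht : ∀ i ∈ t, j ≤ i) (m : M) {x : L}
    (hx : B.tail j x = x) : B.ActsAsLie x (B.vec j) (single t m) := by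
  unfold ActsAsLie
  rw [B.act_vec_single ht, B.act_single_cons_of_tail_eq ht m hx]

/-- No induction on degree is needed. For indices above j and for H this is the defining recursion;
for i < j the roles of e_i and e_j are exchanged, as i is then also below all of t. -/
theorem actsAsLie_vec {j : ι} {t : Multiset ι} (ht : ∀ i ∈ t, j ≤ i) (m : M) (x : L) :
    B.ActsAsLie x (B.vec j) (single t m) := by
  refine B.induction_on (C := fun x => B.ActsAsLie x (B.vec j) (single t m)) (fun i => ?_)
    (fun h => B.actsAsLie_vec_of_tail_eq ht m (B.tail_coe j h)) (fun x y hx hy => hx.add_left hy)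
    (fun a x hx => hx.smul_left a) x
  rcases lt_trichotomy i j with h | rfl | h
  · exact (B.actsAsLie_vec_of_tail_eq (fun k hk => h.le.trans (ht k hk)) m
      (B.tail_vec_of_lt h)).symm
  · exact B.actsAsLie_self _ _
  · exact B.actsAsLie_vec_of_tail_eq ht m (B.tail_vec_of_lt h)

theorem actsAsLie_single_zero (x y : L) (m : M) : B.ActsAsLie x y (single 0 m) := by
  refine B.induction_on (C := fun x => B.ActsAsLie x y (single 0 m))
    (fun i => (B.actsAsLie_vec (by simp) m y).symm) (fun h => ?_)
    (fun x y hx hy => hx.add_left hy) (fun a x hx => hx.smul_left a) x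
  refine ActsAsLie.symm ?_
  refine B.induction_on (C := fun y => B.ActsAsLie y h (single 0 m))
    (fun i => (B.actsAsLie_vec (by simp) m h).symm) (fun g => ?_)
    (fun x y hx hy => hx.add_left hy) (fun a x hx => hx.smul_left a) y
  unfold ActsAsLie
  rw [← LieSubalgebra.coe_bracket]
  simp only [act_coe_single_zero]
  rw [← single_add, leibniz_lie, add_comm]

/-- Write the monomial as e_l w and move both x and y past e_l. The remaining terms act on vectors
covered by induction, and they match by the Jacobi identity. -/
theorem actsAsLie_single_cons {l : ι} {w : Multiset ι} (hw : ∀ i ∈ w, l ≤ i) (m : M) {x y : L}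
    (ih : ∀ v ∈ degreeLT (M := M) F (Multiset.card w + 1), ∀ x y, B.ActsAsLie x y v)
    (hx : ∀ z, B.ActsAsLie z (B.vec l) (B.act M (single w m) x))
    (hy : ∀ z, B.ActsAsLie z (B.vec l) (B.act M (single w m) y)) :
    B.ActsAsLie x y (single (l ::ₘ w) m) := by
  have hw1 : single w m ∈ degreeLT F (Multiset.card w + 1) := single_mem_degreeLT (by simp) m
  rw [← B.act_vec_single hw]
  have h1 := ih _ hw1 x (B.vec l)
  have h2 := ih _ hw1 y (B.vec l)
  have h3 := ih _ hw1 x y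
  have h4 := ih _ hw1 ⁅x, y⁆ (B.vec l)
  have h5 := ih _ hw1 x ⁅y, B.vec l⁆
  have h6 := ih _ hw1 y ⁅x, B.vec l⁆
  have h7 := hx y
  have h8 := hy x
  unfold ActsAsLie at *
  have hJ : B.act M (single w m) ⁅⁅x, y⁆, B.vec l⁆ = B.act M (single w m) ⁅x, ⁅y, B.vec l⁆⁆
      - B.act M (single w m) ⁅y, ⁅x, B.vec l⁆⁆ := by
    rw [lie_lie, map_sub]
  rw [h4, h2, h1]
  simp only [map_add, LinearMap.add_apply]
  rw [h7, h8, h5, h6, hJ, h3]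
  simp only [map_add, LinearMap.add_apply]
  abel

/-- The leading part of x w is zero or a monomial whose indices are all at least l, where the
relation with e_l is known; the rest has degree covered by induction. -/
theorem actsAsLie_vec_act {l : ι} {w : Multiset ι} (hw : ∀ i ∈ w, l ≤ i) (m : M)
    (ih : ∀ v ∈ degreeLT (M := M) F (Multiset.card w + 1), ∀ x y, B.ActsAsLie x y v)
    {x : L} (hx : (∃ i, l ≤ i ∧ x = B.vec i) ∨ ∃ h : H, x = h) (z : L) :
    B.ActsAsLie z (B.vec l) (B.act M (single w m) x) := by
  rw [act_apply]
  refine ActsAsLie.add ?_ (ih _ (B.lower_mem (single_mem_degreeLT (by simp) m) x) _ _)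
  rcases hx with ⟨i, hi, rfl⟩ | ⟨h, rfl⟩
  · rw [lead_vec, shift_single]
    refine B.actsAsLie_vec (fun k hk => ?_) m z
    rcases Multiset.mem_cons.mp hk with rfl | hk
    · exact hi
    · exact hw _ hk
  · rw [lead_coe]
    simp [ActsAsLie]

theorem actsAsLie (x y : L) (v : Multiset ι →₀ M) : B.ActsAsLie x y v := by
  suffices h : ∀ d, ∀ v ∈ degreeLT (M := M) F d, ∀ x y, B.ActsAsLie x y v by
    obtain ⟨d, hd⟩ := exists_mem_degreeLT (F := F) v
    exact h d v hd x y
  intro d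
  induction d with
  | zero =>
    intro v hv x y
    rw [eq_zero_of_mem_degreeLT_zero hv]
    simp [ActsAsLie]
  | succ d ih =>
    intro v hv x y
    refine B.actsAsLie_of_degreeLT (fun s m hs => ?_) hv
    by_cases h : s = 0
    · subst h
      exact B.actsAsLie_single_zero x y m
    obtain ⟨⟨l, w⟩, rfl, hw⟩ := s.exists_eq_cons_forall_le h
    simp only at hw hs ⊢
    have ih' : ∀ v ∈ degreeLT (M := M) F (Multiset.card w + 1), ∀ x y, B.ActsAsLie x y v :=
      fun v hv => ih v (degreeLT_mono (by simpa using hs) hv)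
    -- A basis vector of index at most l is covered directly. What remains is a pair taken from H
    -- and the e_i with i ≥ l.
    have hsmall : ∀ i ≤ l, ∀ y, B.ActsAsLie y (B.vec i) (single (l ::ₘ w) m) := by
      intro i hi y
      refine B.actsAsLie_vec (fun k hk => ?_) m y
      rcases Multiset.mem_cons.mp hk with rfl | hk
      · exact hi
      · exact hi.trans (hw _ hk)
    have hgood : ∀ x y : L, ((∃ i, l ≤ i ∧ x = B.vec i) ∨ ∃ h : H, x = h) →
        ((∃ i, l ≤ i ∧ y = B.vec i) ∨ ∃ h : H, y = h) →
        B.ActsAsLie x y (single (l ::ₘ w) m) := fun x y hx hy =>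
      B.actsAsLie_single_cons hw m ih' (B.actsAsLie_vec_act hw m ih' hx)
        (B.actsAsLie_vec_act hw m ih' hy)
    have hgood' : ∀ x y : L, ((∃ i, l ≤ i ∧ x = B.vec i) ∨ ∃ h : H, x = h) →
        B.ActsAsLie y x (single (l ::ₘ w) m) := by
      intro x y hx
      refine B.induction_on (C := fun y => B.ActsAsLie y x (single (l ::ₘ w) m)) (fun i => ?_)
        (fun h => hgood _ _ (Or.inr ⟨h, rfl⟩) hx) (fun x y hx hy => hx.add_left hy)
        (fun a x hx => hx.smul_left a) y
      rcases le_total i l with hi | hi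
      · exact (hsmall i hi x).symm
      · exact hgood _ _ (Or.inl ⟨i, hi, rfl⟩) hx
    refine B.induction_on (C := fun x => B.ActsAsLie x y (single (l ::ₘ w) m)) (fun i => ?_)
      (fun h => (hgood' _ y (Or.inr ⟨h, rfl⟩)).symm) (fun x y hx hy => hx.add_left hy)
      (fun a x hx => hx.smul_left a) x
    rcases le_total i l with hi | hi
    · exact (hsmall i hi y).symm
    · exact (hgood' _ y (Or.inl ⟨i, hi, rfl⟩)).symm

variable (M) in
/-- The representation of `L` on the module induced from the `H`-module `M`, whose underlying
vector space consists of the combinations of monomials with coefficients in `M`. -/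
noncomputable def rep : L →ₗ⁅F⁆ Module.End F (Multiset ι →₀ M) where
  toLinearMap := (B.act M).flip
  map_lie' := by
    intro x y
    refine LinearMap.ext fun v => ?_
    have h := B.actsAsLie x y v
    unfold ActsAsLie at h
    change B.act M v ⁅x, y⁆ = B.act M (B.act M v y) x - B.act M (B.act M v x) y
    rw [h, add_sub_cancel_left]

theorem rep_apply (x : L) (v : Multiset ι →₀ M) : B.rep M x v = B.act M v x := rfl

end LieSubalgebra.ComplBasis

end RelativePBW

/-! ### Jacobson's formula and the defect x^p - x^[p] - S(x)^p. -/

section Jacobson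

attribute [local instance 100] LieRing.ofAssociativeRing

open Polynomial

/-- Pascal's rule: consecutive coefficients in row p - 1 add up to one in row p that is divisible by
p. -/
theorem CharP.cast_choose_pred_prime (R : Type*) [Ring R] (p : ℕ) [Fact p.Prime] [CharP R p]
    {m : ℕ} (hm : m < p) : ((Nat.choose (p - 1) m : ℕ) : R) = (-1) ^ m := by
  induction m with
  | zero => simp
  | succ m ih =>
    have hp : p - 1 + 1 = p := Nat.succ_pred_prime Fact.out
    have h1 := Nat.choose_succ_succ (p - 1) m
    rw [Nat.succ_eq_add_one, Nat.succ_eq_add_one, hp] at h1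
    have h2 : ((Nat.choose p (m + 1) : ℕ) : R) = 0 := by
      rw [CharP.cast_eq_zero_iff R p]
      exact Nat.Prime.dvd_choose_self Fact.out (Nat.succ_ne_zero m) hm
    rw [h1, Nat.cast_add, ih (by omega)] at h2
    rw [pow_succ, mul_neg, mul_one]
    exact (neg_eq_of_add_eq_zero_right h2).symm

theorem Commute.sub_pow_char_pred {R : Type*} [Ring R] (p : ℕ) [Fact p.Prime] [CharP R p]
    {x y : R} (h : Commute x y) :
    (x - y) ^ (p - 1) = ∑ m ∈ Finset.range p, x ^ m * y ^ (p - 1 - m) := by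
  have hp : p - 1 + 1 = p := Nat.succ_pred_prime Fact.out
  rw [sub_eq_add_neg, h.neg_right.add_pow, hp]
  refine Finset.sum_congr rfl fun m hm => ?_
  have hm' : m ≤ p - 1 := by
    have := Finset.mem_range.mp hm
    omega
  rw [← Nat.choose_symm hm', CharP.cast_choose_pred_prime R p (by omega), neg_pow y,
    mul_assoc, ((Commute.neg_one_left y).pow_pow _ _).eq, mul_assoc, ← mul_pow,
    neg_one_mul, neg_neg, one_pow, mul_one]
  exact Commute.refl _

variable {F A : Type*} [Field F] [Ring A] [Algebra F A] {p : ℕ} [Fact p.Prime] [CharP F p]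

theorem LieAlgebra.ad_pow_char_sub_one_apply (x y : A) :
    ((LieAlgebra.ad F A x) ^ (p - 1)) y
      = ∑ m ∈ Finset.range p, x ^ m * y * x ^ (p - 1 - m) := by
  -- Endomorphisms of the zero algebra do not have characteristic p.
  nontriviality A
  have : CharP (Module.End F A) p :=
    charP_of_injective_algebraMap (algebraMap F (Module.End F A)).injective p
  have h : LieAlgebra.ad F A x = LinearMap.mulLeft F x - LinearMap.mulRight F x := by
    ext z
    simp [LieRing.of_associative_ring_bracket]
  have hc : Commute (LinearMap.mulLeft F x) (LinearMap.mulRight F x) :=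
    LinearMap.commute_mulLeft_right x x
  rw [h, Commute.sub_pow_char_pred p hc, LinearMap.sum_apply]
  refine Finset.sum_congr rfl fun m _ => ?_
  simp [LinearMap.pow_mulLeft, LinearMap.pow_mulRight, mul_assoc]

theorem LieAlgebra.ad_pow_char_apply (x y : A) :
    ((LieAlgebra.ad F A x) ^ p) y = ⁅x ^ p, y⁆ := by
  nontriviality A
  have : CharP (Module.End F A) p :=
    charP_of_injective_algebraMap (algebraMap F (Module.End F A)).injective p
  have h : LieAlgebra.ad F A x = LinearMap.mulLeft F x - LinearMap.mulRight F x := by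
    ext z
    simp [LieRing.of_associative_ring_bracket]
  have hc : Commute (LinearMap.mulLeft F x) (LinearMap.mulRight F x) :=
    LinearMap.commute_mulLeft_right x x
  rw [h, sub_pow_char_of_commute (R := Module.End F A) p hc]
  simp [LinearMap.pow_mulLeft, LinearMap.pow_mulRight, LieRing.of_associative_ring_bracket]

/-- For n = p the sum equals ad(w)^(p-1) applied to the derivative of w, by
`LieAlgebra.ad_pow_char_sub_one_apply`. This is the source of Jacobson's formula. -/
theorem Polynomial.derivative_pow_noncomm (w : A[X]) (n : ℕ) :
    derivative (w ^ n) = ∑ m ∈ Finset.range n, w ^ m * derivative w * w ^ (n - 1 - m) := by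
  induction n with
  | zero => simp
  | succ n ih =>
    rw [pow_succ, derivative_mul, ih, Finset.sum_range_succ, Finset.sum_mul]
    congr 1
    · refine Finset.sum_congr rfl fun m hm => ?_
      have := Finset.mem_range.mp hm
      rw [mul_assoc _ _ w, ← pow_succ]
      congr 2
      omega
    · simp

variable {L : Type*} [LieRing L] [LieAlgebra F L]

/-- The map `F[X] ⊗ L → A[X]` given by a homomorphism `L → A`. -/
noncomputable def LieHom.toPolynomial (f : L →ₗ⁅F⁆ A) : F[X] ⊗[F] L →ₗ[F] A[X] :=
  TensorProduct.lift (LinearMap.mk₂ F (fun g x => g.map (algebraMap F A) * C (f x))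
    (fun g h x => by simp [add_mul])
    (fun c g x => by
      simp only [Polynomial.map_smul, algebraMap_smul]
      ext n
      simp [Algebra.smul_def, mul_assoc])
    (fun g x y => by simp [mul_add])
    (fun c g x => by
      ext n
      simp))

theorem LieHom.toPolynomial_tmul (f : L →ₗ⁅F⁆ A) (g : F[X]) (x : L) :
    f.toPolynomial (g ⊗ₜ x) = g.map (algebraMap F A) * C (f x) := rfl

theorem Polynomial.commute_C_map_algebraMap (a : A) (g : F[X]) :
    Commute (C a) (g.map (algebraMap F A)) := by
  refine Polynomial.ext fun n => ?_
  rw [coeff_C_mul, coeff_mul_C, coeff_map, Algebra.commutes]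

theorem LieHom.toPolynomial_ad (f : L →ₗ⁅F⁆ A) (u v : F[X] ⊗[F] L) :
    f.toPolynomial (LieAlgebra.ad F[X] (F[X] ⊗[F] L) u v)
      = LieAlgebra.ad F A[X] (f.toPolynomial u) (f.toPolynomial v) := by
  induction u using TensorProduct.induction_on with
  | zero => simp only [map_zero, LinearMap.zero_apply]
  | add u u' hu hu' => simp only [map_add, LinearMap.add_apply, hu, hu']
  | tmul g x =>
    induction v using TensorProduct.induction_on with
    | zero => simp only [map_zero]
    | add u u' hu hu' => simp only [map_add, hu, hu']
    | tmul h y =>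
      have h0 : LieAlgebra.ad F[X] (F[X] ⊗[F] L) (g ⊗ₜ x) (h ⊗ₜ y) = (g * h) ⊗ₜ[F] ⁅x, y⁆ := by
        simp [LieAlgebra.ExtendScalars.bracket_tmul]
      rw [h0, LieAlgebra.ad_apply]
      simp only [toPolynomial_tmul, LieHom.map_lie, LieRing.of_associative_ring_bracket,
        Polynomial.map_mul, C_sub, C_mul, mul_sub]
      have h1 := (commute_C_map_algebraMap (f x) h).eq
      have h2 := (commute_C_map_algebraMap (f y) g).eq
      have h3 : Commute (g.map (algebraMap F A)) (h.map (algebraMap F A)) := by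
        have : g * h = h * g := mul_comm g h
        have := congrArg (Polynomial.map (algebraMap F A)) this
        simpa [commute_iff_eq] using this
      congr 1
      · rw [mul_assoc, mul_assoc, ← mul_assoc (C (f x)), h1, mul_assoc]
      · rw [h3.eq, mul_assoc, mul_assoc, ← mul_assoc (C (f y)), h2, mul_assoc]

theorem LieHom.toPolynomial_ad_pow (f : L →ₗ⁅F⁆ A) (u v : F[X] ⊗[F] L) (n : ℕ) :
    f.toPolynomial (((LieAlgebra.ad F[X] (F[X] ⊗[F] L) u) ^ n) v)
      = ((LieAlgebra.ad F A[X] (f.toPolynomial u)) ^ n) (f.toPolynomial v) := by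
  induction n generalizing v with
  | zero => simp
  | succ n ih =>
    rw [pow_succ, pow_succ, Module.End.mul_apply, Module.End.mul_apply, ih, toPolynomial_ad]

/-- Jacobson's formula. -/
theorem IsJacobsonFamily.map_add_pow {a b : L} {s : ℕ → L} (hs : IsJacobsonFamily F p a b s)
    (f : L →ₗ⁅F⁆ A) :
    (f a + f b) ^ p = f a ^ p + f b ^ p + ∑ i ∈ Finset.Icc 1 (p - 1), f (s i) := by
  have hp : p - 1 + 1 = p := Nat.succ_pred_prime Fact.out
  have hp0 : p ≠ 0 := (Fact.out : p.Prime).ne_zero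
  set w : A[X] := X * C (f a) + C (f b) with hw
  have hw' : f.toPolynomial (X ⊗ₜ a + 1 ⊗ₜ b) = w := by
    simp [LieHom.toPolynomial_tmul, hw]
  have hD : derivative w = C (f a) := by simp [hw]
  have h1 := congrArg f.toPolynomial hs
  -- The left side becomes the derivative of w^p. Comparing coefficients of X^(i-1) then gives i
  -- times the coefficient of X^i in w^p against i f(s_i), and i is invertible in F.
  rw [LieHom.toPolynomial_ad_pow, hw', LieAlgebra.ad_pow_char_sub_one_apply,
    LieHom.toPolynomial_tmul, Polynomial.map_one, one_mul, ← hD, ← derivative_pow_noncomm,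
    map_sum] at h1
  have hcoeff : ∀ i ∈ Finset.Icc 1 (p - 1), (w ^ p).coeff i = f (s i) := by
    intro i hi
    obtain ⟨hi1, hi2⟩ := Finset.mem_Icc.mp hi
    have hi0 : (i : F) ≠ 0 := by
      rw [Ne, CharP.cast_eq_zero_iff F p]
      exact fun h => absurd (Nat.le_of_dvd hi1 h) (by omega)
    have h2 := congrArg (fun q => coeff q (i - 1)) h1
    simp only [coeff_derivative, finsetSum_coeff] at h2
    rw [Finset.sum_eq_single i] at h2
    · have h3 : ((i - 1 : ℕ) : A) + 1 = ((i : F) : F) • (1 : A) := by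
        rw [← Nat.cast_succ, Nat.succ_eq_add_one, Nat.sub_add_cancel hi1, Nat.cast_smul_eq_nsmul]
        simp
      rw [h3, mul_smul_comm, mul_one, map_nsmul, coeff_smul, LieHom.toPolynomial_tmul,
        ← Nat.cast_smul_eq_nsmul F] at h2
      have h4 := smul_right_injective A hi0 h2
      rw [Nat.sub_add_cancel hi1] at h4
      rw [h4]
      simp
    · intro j hj hji
      have hne : j - 1 ≠ i - 1 := by
        have := (Finset.mem_Icc.mp hj).1
        omega
      simp [LieHom.toPolynomial_tmul, coeff_X_pow, Ne.symm hne]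
    · exact fun h => absurd hi h
  have hdeg : w.natDegree ≤ 1 := by
    rw [hw]
    refine natDegree_add_le_of_degree_le (natDegree_mul_C_le _ _ |>.trans natDegree_X_le) ?_
    simp
  have htop : (w ^ p).coeff p = f a ^ p := by
    have := coeff_pow_of_natDegree_le hdeg (m := p)
    rw [mul_one] at this
    rw [this]
    simp [hw]
  have hbot : (w ^ p).coeff 0 = f b ^ p := by
    have : constantCoeff (w ^ p) = constantCoeff w ^ p := map_pow _ _ _
    simpa [hw] using this
  have heval : (w ^ p).eval 1 = (f a + f b) ^ p := by
    have : eval₂RingHom' (RingHom.id A) 1 (fun a => Commute.one_right a) (w ^ p)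
      = (eval₂RingHom' (RingHom.id A) 1 (fun a => Commute.one_right a) w) ^ p := map_pow _ _ _
    have hv : eval₂RingHom' (RingHom.id A) 1 (fun a => Commute.one_right a) w = f a + f b := by
      simp [hw]
    rw [hv] at this
    exact this
  have hdeg' : (w ^ p).natDegree < p + 1 := by
    have := natDegree_pow_le_of_le p hdeg
    omega
  -- Evaluating w^p at X = 1 adds its coefficients: f(a)^p on top, f(b)^p at the bottom, and the
  -- f(s_i) between.
  rw [← heval, eval_eq_sum_range' hdeg', Finset.sum_range_succ, htop]
  simp only [one_pow, mul_one]
  rw [Finset.range_eq_Ico, Finset.sum_eq_sum_Ico_succ_bot (Nat.pos_of_ne_zero hp0), hbot]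
  have hIco : Finset.Ico (0 + 1) p = Finset.Icc 1 (p - 1) := by
    ext i
    simp only [Finset.mem_Ico, Finset.mem_Icc]
    omega
  rw [hIco, Finset.sum_congr rfl hcoeff]
  abel

/-- The element `f(x) ^ p - f(x^[p]) - S(x) ^ p`. -/
noncomputable def PMap.defect (P : PMap F L p) (S : Module.Dual F L) (f : L →ₗ⁅F⁆ A) (x : L) : A :=
  f x ^ p - f (P x) - algebraMap F A (S x ^ p)

/-- With `PMap.defect_smul` this makes the defect p-semilinear, so its vanishing can be tested on H
and the e_i. -/
theorem PMap.defect_add (P : PMap F L p) (S : Module.Dual F L) (f : L →ₗ⁅F⁆ A) (x y : L) :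
    P.defect S f (x + y) = P.defect S f x + P.defect S f y := by
  obtain ⟨s, hs, hadd⟩ := P.add_toFun x y
  have h := hs.map_add_pow f
  unfold PMap.defect
  rw [hadd, map_add f x y, h, map_add S, add_pow_char, map_add, map_add, map_add, map_sum]
  abel

theorem PMap.defect_smul (P : PMap F L p) (S : Module.Dual F L) (f : L →ₗ⁅F⁆ A) (c : F) (x : L) :
    P.defect S f (c • x) = c ^ p • P.defect S f x := by
  unfold PMap.defect
  rw [P.smul_toFun, map_smul f, map_smul f, map_smul S, _root_.smul_pow, smul_eq_mul, mul_pow,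
    smul_sub, smul_sub, Algebra.algebraMap_eq_smul_one, Algebra.algebraMap_eq_smul_one, mul_smul]

theorem LieHom.map_ad_pow (f : L →ₗ⁅F⁆ A) (x y : L) (n : ℕ) :
    f (((LieAlgebra.ad F L x) ^ n) y) = ((LieAlgebra.ad F A (f x)) ^ n) (f y) := by
  induction n generalizing y with
  | zero => simp
  | succ n ih =>
    rw [pow_succ, pow_succ, Module.End.mul_apply, Module.End.mul_apply, ih, LieAlgebra.ad_apply,
      LieAlgebra.ad_apply, LieHom.map_lie]

/-- Both f(x)^p and f(x^[p]) induce ad(f(x))^p on the image of f. -/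
theorem PMap.commute_defect (P : PMap F L p) (S : Module.Dual F L) (f : L →ₗ⁅F⁆ A) (x y : L) :
    Commute (P.defect S f x) (f y) := by
  have h := f.map_ad_pow x y p
  rw [← P.ad_toFun, LieAlgebra.ad_pow_char_apply, LieAlgebra.ad_apply, LieHom.map_lie] at h
  refine Commute.sub_left ?_ (Algebra.commutes _ _)
  rw [LieRing.of_associative_ring_bracket, LieRing.of_associative_ring_bracket] at h
  rw [commute_iff_eq, sub_mul, mul_sub]
  rw [sub_eq_sub_iff_add_eq_add] at h ⊢
  rw [add_comm (f (P x) * f y), add_comm (f x ^ p * f y)] at h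
  rw [h, add_comm]

theorem PMap.commute_defect_defect (P : PMap F L p) (S : Module.Dual F L) (f : L →ₗ⁅F⁆ A)
    (x y : L) : Commute (P.defect S f x) (P.defect S f y) :=
  (((P.commute_defect S f x y).pow_right p).sub_right (P.commute_defect S f x (P y))).sub_right
    (Algebra.commutes _ _).symm

end Jacobson

/-! ### Division of exponents by p, and unitriangular maps. -/

namespace Multiset

variable {ι : Type*} [Fintype ι] [DecidableEq ι]

/-- The multiset whose multiplicities are the quotients by `p` of those of `s`. -/
def quo (p : ℕ) (s : Multiset ι) : Multiset ι := ∑ i, (s.count i / p) • {i}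

/-- The multiset whose multiplicities are the remainders modulo `p` of those of `s`. -/
def res (p : ℕ) (s : Multiset ι) : Multiset ι := ∑ i, (s.count i % p) • {i}

@[simp] theorem count_quo (p : ℕ) (s : Multiset ι) (i : ι) : (s.quo p).count i = s.count i / p := by
  simp [quo, Multiset.count_sum', Multiset.count_singleton]

@[simp] theorem count_res (p : ℕ) (s : Multiset ι) (i : ι) : (s.res p).count i = s.count i % p := by
  simp [res, Multiset.count_sum', Multiset.count_singleton]

theorem nsmul_quo_add_res (p : ℕ) (s : Multiset ι) : p • s.quo p + s.res p = s := by
  ext i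
  simp [Nat.div_add_mod]

theorem quo_nsmul_add {p : ℕ} (hp : 0 < p) (i : ι) (s : Multiset ι) :
    (p • {i} + s).quo p = i ::ₘ s.quo p := by
  ext j
  by_cases h : j = i
  · subst h
    simp [Nat.add_div_left _ hp]
  · simp [h]

theorem res_nsmul_add (p : ℕ) (i : ι) (s : Multiset ι) : (p • {i} + s).res p = s.res p := by
  ext j
  by_cases h : j = i
  · subst h
    simp
  · simp [h]

end Multiset

namespace Finsupp

variable {F ι M : Type*} [Ring F] [AddCommGroup M] [Module F M]

/-- T is the identity plus a map lowering degree, hence invertible by induction on degree. -/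
theorem bijective_of_sub_mem_degreeLT (T : (Multiset ι →₀ M) →ₗ[F] (Multiset ι →₀ M))
    (hT : ∀ s m, T (single s m) - single s m ∈ degreeLT F (Multiset.card s)) :
    Function.Bijective T := by
  have hT' : ∀ d, ∀ v ∈ degreeLT (M := M) F (d + 1), T v - v ∈ degreeLT F d := fun d v hv =>
    map_mem_of_mem_degreeLT (T - LinearMap.id) _
      (fun s m hs => degreeLT_mono (Nat.lt_succ_iff.mp hs) (hT s m)) hv
  constructor
  · rw [← LinearMap.ker_eq_bot, LinearMap.ker_eq_bot']
    intro v hv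
    obtain ⟨d, hd⟩ := exists_mem_degreeLT (F := F) v
    induction d with
    | zero => exact eq_zero_of_mem_degreeLT_zero hd
    | succ d ih =>
      have := hT' d v hd
      rw [hv, zero_sub, neg_mem_iff] at this
      exact ih this
  · intro v
    obtain ⟨d, hd⟩ := exists_mem_degreeLT (F := F) v
    induction d generalizing v with
    | zero => exact ⟨0, by rw [map_zero, eq_zero_of_mem_degreeLT_zero hd]⟩
    | succ d ih =>
      obtain ⟨w, hw⟩ := ih _ (hT' d v hd)
      exact ⟨v - w, by rw [map_sub, hw, sub_sub_cancel]⟩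

end Finsupp

/-! ### The reduced induced module as a quotient by central operators. -/

section ReducedInduced

attribute [local instance 100] LieRing.ofAssociativeRing

namespace LieSubalgebra.ComplBasis

open Finsupp

variable {F L M ι : Type*} [Field F] [LieRing L] [LieAlgebra F L] {H : LieSubalgebra F L}
  [Fintype ι] [LinearOrder ι] (B : H.ComplBasis ι) [AddCommGroup M] [Module F M]
  [LieRingModule H M] [LieModule F H M] {p : ℕ} [Fact p.Prime] [CharP F p]
  (P : PMap F L p) (S : Module.Dual F L)

theorem rep_mem {d : ℕ} {v : Multiset ι →₀ M} (hv : v ∈ degreeLT F d) (x : L) :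
    B.rep M x v ∈ degreeLT F (d + 1) := B.act_mem hv x

theorem rep_pow_mem {d : ℕ} {v : Multiset ι →₀ M} (hv : v ∈ degreeLT F d) (x : L) (n : ℕ) :
    (B.rep M x ^ n) v ∈ degreeLT F (d + n) := by
  induction n with
  | zero => simpa using hv
  | succ n ih =>
    rw [pow_succ', Module.End.mul_apply]
    exact B.rep_mem ih x

theorem shift_pow_mem {d : ℕ} {v : Multiset ι →₀ M} (hv : v ∈ degreeLT F d) (i : ι) (n : ℕ) :
    (shift F M i ^ n) v ∈ degreeLT F (d + n) := by
  induction n with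
  | zero => simpa using hv
  | succ n ih =>
    rw [pow_succ', Module.End.mul_apply]
    exact shift_mem i ih

theorem shift_pow_single (i : ι) (n : ℕ) (s : Multiset ι) (m : M) :
    (shift F M i ^ n) (single s m) = single (n • {i} + s) m := by
  induction n with
  | zero => simp
  | succ n ih =>
    rw [pow_succ', Module.End.mul_apply, ih, shift_single, succ_nsmul', add_assoc,
      Multiset.singleton_add]

theorem rep_vec_pow_sub_mem {d : ℕ} {v : Multiset ι →₀ M} (hv : v ∈ degreeLT F (d + 1)) (i : ι)
    (n : ℕ) : (B.rep M (B.vec i) ^ n) v - (shift F M i ^ n) v ∈ degreeLT F (d + n) := by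
  induction n with
  | zero => simp
  | succ n ih =>
    have h : (B.rep M (B.vec i) ^ (n + 1)) v - (shift F M i ^ (n + 1)) v
        = B.rep M (B.vec i) ((B.rep M (B.vec i) ^ n) v - (shift F M i ^ n) v)
          + B.lower M ((shift F M i ^ n) v) (B.vec i) := by
      rw [pow_succ', pow_succ', Module.End.mul_apply, Module.End.mul_apply, map_sub,
        B.rep_apply _ ((shift F M i ^ n) v), act_apply, lead_vec]
      abel
    rw [h]
    refine Submodule.add_mem _ (B.rep_mem ih _) (B.lower_mem ?_ _)
    have := shift_pow_mem hv i n
    rwa [add_right_comm] at this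

variable (M) in
/-- The central operator `e ^ p - e^[p] - S(e) ^ p` for the basis vector `e` of index `i`. -/
noncomputable def central (i : ι) : Module.End F (Multiset ι →₀ M) :=
  P.defect S (B.rep M) (B.vec i)

theorem defect_apply (x : L) (v : Multiset ι →₀ M) : P.defect S (B.rep M) x v
    = (B.rep M x ^ p) v - B.rep M (P x) v - S x ^ p • v := by
  simp [PMap.defect, Algebra.algebraMap_eq_smul_one]

theorem central_sub_mem {d : ℕ} {v : Multiset ι →₀ M} (hv : v ∈ degreeLT F (d + 1)) (i : ι) :
    B.central M P S i v - (shift F M i ^ p) v ∈ degreeLT F (d + p) := by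
  -- As p ≥ 2, the terms e^[p] and S(e)^p have degree below p and leave the leading term e^p alone.
  have hp : 2 ≤ p := (Fact.out : p.Prime).two_le
  have h1 : B.rep M (P (B.vec i)) v ∈ degreeLT F (d + p) :=
    degreeLT_mono (by omega) (B.rep_mem hv _)
  have h2 : v ∈ degreeLT F (d + p) := degreeLT_mono (by omega) hv
  rw [central, defect_apply, sub_right_comm, sub_right_comm _ (B.rep M (P (B.vec i)) v)]
  exact Submodule.sub_mem _ (Submodule.sub_mem _ (B.rep_vec_pow_sub_mem hv i p) h1)
    (Submodule.smul_mem _ _ h2)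

theorem central_mem {d : ℕ} {v : Multiset ι →₀ M} (hv : v ∈ degreeLT F d) (i : ι) :
    B.central M P S i v ∈ degreeLT F (d + p) := by
  have hp : 2 ≤ p := (Fact.out : p.Prime).two_le
  rw [central, defect_apply]
  refine Submodule.sub_mem _ (Submodule.sub_mem _ (B.rep_pow_mem hv _ p) ?_) ?_
  · exact degreeLT_mono (by omega) (B.rep_mem hv _)
  · exact Submodule.smul_mem _ _ (degreeLT_mono (by omega) hv)

theorem central_central (i j : ι) (v : Multiset ι →₀ M) :
    B.central M P S i (B.central M P S j v) = B.central M P S j (B.central M P S i v) :=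
  LinearMap.congr_fun (P.commute_defect_defect S (B.rep M) (B.vec i) (B.vec j)).eq v

theorem central_rep (i : ι) (x : L) (v : Multiset ι →₀ M) :
    B.central M P S i (B.rep M x v) = B.rep M x (B.central M P S i v) :=
  LinearMap.congr_fun (P.commute_defect S (B.rep M) (B.vec i) x).eq v

/-- Makes `Multiset.foldr` in `normalize` independent of the order of the factors. -/
instance leftCommutative_central : LeftCommutative
    (fun (i : ι) (f : M →ₗ[F] (Multiset ι →₀ M)) => (B.central M P S i).comp f) where
  left_comm i j f := LinearMap.ext fun m => B.central_central P S i j (f m)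

variable (M) in
/-- The linear map sending the monomial `e ^ (a + p b)` with `a < p` to `e ^ a` multiplied by the
monomial with exponents `b` in the central operators. -/
noncomputable def normalize : (Multiset ι →₀ M) →ₗ[F] (Multiset ι →₀ M) :=
  Finsupp.lsum F fun s => (s.quo p).foldr
    (fun (i : ι) (f : M →ₗ[F] (Multiset ι →₀ M)) => (B.central M P S i).comp f)
    (Finsupp.lsingle (s.res p))

theorem normalize_single_sub_mem (s : Multiset ι) (m : M) :
    B.normalize M P S (single s m) - single s m ∈ degreeLT F (Multiset.card s) := by
  have key : ∀ a b : Multiset ι, b.foldr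
      (fun (i : ι) (f : M →ₗ[F] (Multiset ι →₀ M)) => (B.central M P S i).comp f)
      (Finsupp.lsingle a) m - single (p • b + a) m ∈ degreeLT F (Multiset.card (p • b + a)) := by
    intro a b
    induction b using Multiset.induction_on with
    | empty => simp
    | cons i b ih =>
      rw [Multiset.foldr_cons, LinearMap.comp_apply]
      have h1 := B.central_mem P S ih i
      have h2 := B.central_sub_mem P S
        (single_mem_degreeLT (F := F) (Nat.lt_succ_self (Multiset.card (p • b + a))) m) i
      have h3 : p • (i ::ₘ b) + a = p • {i} + (p • b + a) := by
        rw [← Multiset.singleton_add, nsmul_add, add_assoc]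
      have h4 : Multiset.card (p • (i ::ₘ b) + a) = Multiset.card (p • b + a) + p := by
        rw [h3, Multiset.card_add, Multiset.card_nsmul, Multiset.card_singleton]
        ring
      rw [h4, h3, ← shift_pow_single (F := F)]
      have h5 := Submodule.add_mem _ h1 h2
      rwa [map_sub, sub_add_sub_cancel] at h5
  have h := key (s.res p) (s.quo p)
  rw [Multiset.nsmul_quo_add_res] at h
  simpa [normalize] using h

theorem normalize_bijective : Function.Bijective (B.normalize M P S) :=
  bijective_of_sub_mem_degreeLT _ (B.normalize_single_sub_mem P S)

/-- Through `normalize`, the quotient by the z_i is compared with the visible quotient by the e_i^p.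
-/
theorem normalize_shift_pow (i : ι) (v : Multiset ι →₀ M) :
    B.normalize M P S ((shift F M i ^ p) v) = B.central M P S i (B.normalize M P S v) := by
  have hp : 0 < p := (Fact.out : p.Prime).pos
  obtain ⟨d, hd⟩ := exists_mem_degreeLT (F := F) v
  refine map_eq_of_mem_degreeLT ((B.normalize M P S).comp (shift F M i ^ p))
    ((B.central M P S i).comp (B.normalize M P S)) (fun s m _ => ?_) hd
  simp only [LinearMap.comp_apply, shift_pow_single, normalize, Finsupp.lsum_single,
    Multiset.quo_nsmul_add hp, Multiset.res_nsmul_add, Multiset.foldr_cons]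

theorem normalize_single_of_quo_eq_zero {s : Multiset ι} (hs : s.quo p = 0) (m : M) :
    B.normalize M P S (single s m) = single s m := by
  have h := Multiset.nsmul_quo_add_res p s
  rw [hs, smul_zero, zero_add] at h
  simp [normalize, hs, h]

variable (M) in
/-- The subspace generated by the images of the central operators. -/
noncomputable def relations : Submodule F (Multiset ι →₀ M) :=
  ⨆ i, LinearMap.range (B.central M P S i)

theorem central_mem_relations (i : ι) (v : Multiset ι →₀ M) :
    B.central M P S i v ∈ B.relations M P S :=
  Submodule.mem_iSup_of_mem i ⟨v, rfl⟩

/-- Every relation is the image under `normalize` of a combination of multiples of the e_i^p. Such a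
combination has no constant term, while `normalize` is injective and fixes constants. -/
theorem eq_zero_of_single_zero_mem_relations {m : M} (hm : single 0 m ∈ B.relations M P S) :
    m = 0 := by
  have hp : p ≠ 0 := (Fact.out : p.Prime).ne_zero
  have hle : B.relations M P S
      ≤ (LinearMap.ker (Finsupp.lapply (R := F) (0 : Multiset ι) (M := M))).map
        (B.normalize M P S) := by
    refine iSup_le fun i => ?_
    rintro _ ⟨v, rfl⟩
    obtain ⟨w, rfl⟩ := (B.normalize_bijective P S).2 v
    refine ⟨(shift F M i ^ p) w, ?_, B.normalize_shift_pow P S i w⟩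
    obtain ⟨d, hd⟩ := exists_mem_degreeLT (F := F) w
    refine map_mem_of_mem_degreeLT (shift F M i ^ p) _ (fun s m _ => ?_) hd
    rw [shift_pow_single, LinearMap.mem_ker, Finsupp.lapply_apply, Finsupp.single_eq_of_ne']
    intro h
    have := congrArg Multiset.card h
    simp [hp] at this
  obtain ⟨w, hw, hwm⟩ := hle hm
  have h0 : (0 : Multiset ι).quo p = 0 := by
    ext i
    simp
  rw [← B.normalize_single_of_quo_eq_zero P S h0 m] at hwm
  rw [(B.normalize_bijective P S).1 hwm] at hw
  simpa using hw

theorem exists_sub_mem_relations (v : Multiset ι →₀ M) : ∃ w : Multiset ι →₀ M,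
    v - w ∈ B.relations M P S ∧ ∀ s, w s ≠ 0 → ∀ i, s.count i < p := by
  have hp : 0 < p := (Fact.out : p.Prime).pos
  have h : v ∈ B.relations M P S ⊔ Finsupp.supported M F {s | ∀ i, s.count i < p} := by
    obtain ⟨w, rfl⟩ := (B.normalize_bijective P S).2 v
    obtain ⟨d, hd⟩ := exists_mem_degreeLT (F := F) w
    refine map_mem_of_mem_degreeLT _ _ (fun s m _ => ?_) hd
    by_cases hs : s.quo p = 0
    · rw [B.normalize_single_of_quo_eq_zero P S hs]
      refine Submodule.mem_sup_right (Finsupp.single_mem_supported F m fun i => ?_)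
      have := congrArg (Multiset.count i) hs
      rw [Multiset.count_quo, Multiset.count_zero, Nat.div_eq_zero_iff] at this
      omega
    · obtain ⟨i, hi⟩ := Multiset.exists_mem_of_ne_zero hs
      obtain ⟨b, hb⟩ := Multiset.exists_cons_of_mem hi
      refine Submodule.mem_sup_left ?_
      simp only [normalize, Finsupp.lsum_single, hb, Multiset.foldr_cons, LinearMap.comp_apply]
      exact B.central_mem_relations P S _ _
  obtain ⟨r, hr, w, hw, rfl⟩ := Submodule.mem_sup.mp h
  refine ⟨w, by simpa using hr, fun s hs => ?_⟩
  exact hw (Finsupp.mem_support_iff.mpr hs)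

theorem rep_mem_relations (x : L) :
    B.relations M P S ≤ (B.relations M P S).comap (B.rep M x) := by
  refine iSup_le fun i => ?_
  rintro _ ⟨v, rfl⟩
  rw [Submodule.mem_comap, ← central_rep]
  exact B.central_mem_relations P S _ _

theorem eq_top_of_rep_mem (N : Submodule F (Multiset ι →₀ M)) (h0 : ∀ m, single 0 m ∈ N)
    (hN : ∀ x, ∀ v ∈ N, B.rep M x v ∈ N) : N = ⊤ := by
  have key : ∀ n, ∀ s : Multiset ι, Multiset.card s = n → ∀ m, single s m ∈ N := by
    intro n
    induction n with
    | zero =>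
      intro s hs m
      rw [Multiset.card_eq_zero.mp hs]
      exact h0 m
    | succ n ih =>
      intro s hs m
      obtain ⟨⟨j, t⟩, rfl, ht⟩ := s.exists_eq_cons_forall_le (by
        rintro rfl
        simp at hs)
      have := hN (B.vec j) _ (ih t (by simpa using hs) m)
      rwa [rep_apply, B.act_vec_single ht] at this
  refine Submodule.eq_top_iff'.mpr fun v => ?_
  obtain ⟨d, hd⟩ := exists_mem_degreeLT (F := F) v
  exact map_mem_of_mem_degreeLT LinearMap.id N (fun s m _ => key _ s rfl m) hd

variable (M) in
/-- The representation of `L` on the reduced induced module. -/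
noncomputable def redRep : L →ₗ⁅F⁆ Module.End F ((Multiset ι →₀ M) ⧸ B.relations M P S) where
  toFun x := (B.relations M P S).mapQ _ (B.rep M x) (B.rep_mem_relations P S x)
  map_add' x y := by
    ext v
    simp
  map_smul' c x := by
    ext v
    simp
  map_lie' := by
    intro x y
    refine Submodule.linearMap_qext _ (LinearMap.ext fun v => ?_)
    simp [LieRing.of_associative_ring_bracket]

theorem redRep_mk (x : L) (v : Multiset ι →₀ M) :
    B.redRep M P S x ((B.relations M P S).mkQ v) = (B.relations M P S).mkQ (B.rep M x v) := rfl

theorem defect_redRep_mk (x : L) (v : Multiset ι →₀ M) :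
    P.defect S (B.redRep M P S) x ((B.relations M P S).mkQ v)
      = (B.relations M P S).mkQ (P.defect S (B.rep M) x v) := by
  have hpow : ∀ n, (B.redRep M P S x ^ n) ((B.relations M P S).mkQ v)
      = (B.relations M P S).mkQ ((B.rep M x ^ n) v) := by
    intro n
    induction n with
    | zero => rfl
    | succ n ih =>
      rw [pow_succ', pow_succ', Module.End.mul_apply, Module.End.mul_apply, ih, redRep_mk]
  rw [defect_apply, map_sub, map_sub, ← hpow, ← redRep_mk, map_smul]
  simp [PMap.defect, Algebra.algebraMap_eq_smul_one]

variable {P S}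

theorem rep_coe_pow_single_zero (h : H) (n : ℕ) (m : M) :
    (B.rep M (h : L) ^ n) (single 0 m) = single 0 ((LieModule.toEnd F H M h ^ n) m) := by
  induction n with
  | zero => simp
  | succ n ih =>
    rw [pow_succ', pow_succ', Module.End.mul_apply, Module.End.mul_apply, ih, rep_apply,
      act_coe_single_zero, LieModule.toEnd_apply_apply]

/-- The defect commutes with L, so its kernel is L-stable. It contains degree zero by the character
of M, and degree zero generates. -/
theorem defect_rep_coe {hH : IsPSubalgebra P H}
    (hM : HasCharacter (P.restrict H hH) (restrictDual S H) M) (h : H) :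
    P.defect S (B.rep M) h = 0 := by
  rw [← LinearMap.ker_eq_top]
  refine B.eq_top_of_rep_mem _ (fun m => ?_) fun x v hv => ?_
  · have h1 := LinearMap.congr_fun (hM h) m
    have h2 : B.rep M (P h) (single 0 m) = single 0 ⁅P.restrict H hH h, m⁆ :=
      B.act_coe_single_zero (P.restrict H hH h) m
    rw [LinearMap.mem_ker, defect_apply, rep_coe_pow_single_zero, h2, ← single_sub, smul_single,
      ← single_sub, single_eq_zero, sub_eq_zero]
    exact h1
  · rw [LinearMap.mem_ker] at hv ⊢
    have h1 := LinearMap.congr_fun (P.commute_defect S (B.rep M) h x).eq v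
    rw [Module.End.mul_apply, Module.End.mul_apply, hv, map_zero] at h1
    exact h1

theorem defect_redRep {hH : IsPSubalgebra P H}
    (hM : HasCharacter (P.restrict H hH) (restrictDual S H) M) (x : L) :
    P.defect S (B.redRep M P S) x = 0 := by
  refine B.induction_on (C := fun x => P.defect S (B.redRep M P S) x = 0) (fun i => ?_)
    (fun h => ?_) (fun x y hx hy => by rw [P.defect_add, hx, hy, add_zero])
    (fun c x hx => by rw [P.defect_smul, hx, smul_zero]) x
  · refine Submodule.linearMap_qext _ (LinearMap.ext fun v => ?_)
    rw [LinearMap.comp_apply, defect_redRep_mk]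
    simpa [central] using B.central_mem_relations P S i v
  · refine Submodule.linearMap_qext _ (LinearMap.ext fun v => ?_)
    rw [LinearMap.comp_apply, defect_redRep_mk, B.defect_rep_coe hM]
    simp

end LieSubalgebra.ComplBasis

end ReducedInduced

/-! ### Maps out of the induced modules. -/

section InducedMaps

attribute [local instance 100] LieRing.ofAssociativeRing

namespace LieSubalgebra.ComplBasis

open Finsupp

variable {F L M ι : Type*} [Field F] [LieRing L] [LieAlgebra F L] {H : LieSubalgebra F L}
  [Fintype ι] [LinearOrder ι] (B : H.ComplBasis ι) [AddCommGroup M] [Module F M]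
  [LieRingModule H M] [LieModule F H M] {W : Type*} [AddCommGroup W] [Module F W]
  (f : L →ₗ⁅F⁆ Module.End F W) (j : M →ₗ[F] W)

/-- The extension of an `H`-homomorphism from `M` to a representation of `L` to the module induced
from `M`. -/
noncomputable def extend : (Multiset ι →₀ M) →ₗ[F] W :=
  Finsupp.lsum F fun s => ((s.sort (· ≤ ·)).map fun i => f (B.vec i)).prod.comp j

theorem extend_single_zero (m : M) : B.extend f j (single 0 m) = j m := by
  simp [extend]

theorem extend_single_cons {i : ι} {s : Multiset ι} (hs : ∀ k ∈ s, i ≤ k) (m : M) :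
    B.extend f j (single (i ::ₘ s) m) = f (B.vec i) (B.extend f j (single s m)) := by
  simp only [extend, Finsupp.lsum_single]
  rw [Multiset.sort_cons (r := (· ≤ ·)) _ _ hs]
  simp

variable {j}

theorem extend_rep (hj : ∀ (h : H) (m : M), j ⁅h, m⁆ = f (h : L) (j m)) (x : L)
    (v : Multiset ι →₀ M) : B.extend f j (B.rep M x v) = f x (B.extend f j v) := by
  suffices h : ∀ d, ∀ v ∈ degreeLT (M := M) F d, ∀ x,
      B.extend f j (B.act M v x) = f x (B.extend f j v) by
    obtain ⟨d, hd⟩ := exists_mem_degreeLT (F := F) v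
    exact h d v hd x
  intro d
  induction d with
  | zero =>
    intro v hv x
    rw [eq_zero_of_mem_degreeLT_zero hv]
    simp
  | succ d ih =>
    intro v hv x
    refine map_eq_of_mem_degreeLT ((B.extend f j).comp ((B.act M).flip x))
      ((f x).comp (B.extend f j)) (fun s m hs => ?_) hv
    simp only [LinearMap.comp_apply, LinearMap.flip_apply]
    have hadd : ∀ x y, B.extend f j (B.act M (single s m) x) = f x (B.extend f j (single s m)) →
        B.extend f j (B.act M (single s m) y) = f y (B.extend f j (single s m)) →
        B.extend f j (B.act M (single s m) (x + y))
          = f (x + y) (B.extend f j (single s m)) := by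
      intro x y hx hy
      simp only [map_add, hx, hy, LinearMap.add_apply]
    have hsmul : ∀ (c : F) x,
        B.extend f j (B.act M (single s m) x) = f x (B.extend f j (single s m)) →
        B.extend f j (B.act M (single s m) (c • x)) = f (c • x) (B.extend f j (single s m)) := by
      intro c x hx
      simp only [map_smul, hx, LinearMap.smul_apply]
    by_cases h : s = 0
    · subst h
      refine B.induction_on (C := fun x => B.extend f j (B.act M (single 0 m) x)
        = f x (B.extend f j (single 0 m))) (fun i => ?_) (fun g => ?_) hadd hsmul x
      · rw [B.act_vec_single (by simp), B.extend_single_cons f j (by simp)]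
      · rw [act_coe_single_zero, extend_single_zero, extend_single_zero, hj]
    obtain ⟨⟨l, t⟩, rfl, ht⟩ := s.exists_eq_cons_forall_le h
    simp only at ht hs hadd hsmul ⊢
    have ht1 : single t m ∈ degreeLT F (Multiset.card t + 1) := single_mem_degreeLT (by simp) m
    have htd : Multiset.card t + 1 ≤ d := by simpa using hs
    -- Moving x past e_l leaves one term outside the induction: e_l applied to the leading part of x
    -- t. It vanishes for x in H and is an ordered monomial for e_i with i ≥ l.
    have key : ∀ x, B.extend f j (B.act M (B.lead M (single t m) x) (B.vec l))
        = f (B.vec l) (B.extend f j (B.lead M (single t m) x)) →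
        B.extend f j (B.act M (single (l ::ₘ t) m) x)
        = f x (B.extend f j (single (l ::ₘ t) m)) := by
      intro x hx
      have h1 := B.actsAsLie x (B.vec l) (single t m)
      unfold ActsAsLie at h1
      have h2 := ih _ (degreeLT_mono htd (B.lower_mem ht1 x)) (B.vec l)
      have h3 := ih _ (degreeLT_mono htd ht1) x
      have h4 := ih _ (degreeLT_mono htd ht1) ⁅x, B.vec l⁆
      have h5 : B.extend f j (B.act M (B.act M (single t m) x) (B.vec l))
          = f (B.vec l) (B.extend f j (B.act M (single t m) x)) := by
        simp only [B.act_apply (single t m) x, map_add, LinearMap.add_apply, hx, h2]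
      rw [← B.act_vec_single ht, h1, map_add, h5, h3, h4, B.act_vec_single ht,
        B.extend_single_cons f j ht, LieHom.map_lie, LieRing.of_associative_ring_bracket]
      simp
    refine B.induction_on (C := fun x => B.extend f j (B.act M (single (l ::ₘ t) m) x)
        = f x (B.extend f j (single (l ::ₘ t) m))) (fun i => ?_) (fun g => ?_) hadd hsmul x
    · rcases le_total i l with hi | hi
      · have hi' : ∀ k ∈ l ::ₘ t, i ≤ k := by
          intro k hk
          rcases Multiset.mem_cons.mp hk with rfl | hk
          · exact hi
          · exact hi.trans (ht _ hk)
        rw [B.act_vec_single hi', B.extend_single_cons f j hi']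
      · refine key _ ?_
        have hi' : ∀ k ∈ i ::ₘ t, l ≤ k := by
          intro k hk
          rcases Multiset.mem_cons.mp hk with rfl | hk
          · exact hi
          · exact ht _ hk
        rw [lead_vec, shift_single, B.act_vec_single hi', B.extend_single_cons f j hi']
    · refine key _ ?_
      simp [lead_coe]

theorem extend_relations {p : ℕ} [Fact p.Prime] [CharP F p] {P : PMap F L p}
    {S : Module.Dual F L} (hj : ∀ (h : H) (m : M), j ⁅h, m⁆ = f (h : L) (j m))
    (hf : ∀ x, P.defect S f x = 0) {v : Multiset ι →₀ M} (hv : v ∈ B.relations M P S) :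
    B.extend f j v = 0 := by
  suffices h : B.relations M P S ≤ LinearMap.ker (B.extend f j) from h hv
  refine iSup_le fun i => ?_
  rintro _ ⟨w, rfl⟩
  have hpow : ∀ n, B.extend f j ((B.rep M (B.vec i) ^ n) w)
      = (f (B.vec i) ^ n) (B.extend f j w) := by
    intro n
    induction n with
    | zero => rfl
    | succ n ih =>
      rw [pow_succ', pow_succ', Module.End.mul_apply, Module.End.mul_apply, B.extend_rep f hj, ih]
  have h1 := LinearMap.congr_fun (hf (B.vec i)) (B.extend f j w)
  rw [LinearMap.mem_ker, central, defect_apply, map_sub, map_sub, map_smul, hpow,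
    B.extend_rep f hj]
  simpa [PMap.defect, Algebra.algebraMap_eq_smul_one] using h1

end LieSubalgebra.ComplBasis

variable {F L : Type*} {p : ℕ} [Field F] [LieRing L] [LieAlgebra F L]

/-- Lift the canonical map to the generated subalgebra; by uniqueness, following this by the
inclusion is the identity. -/
theorem ReducedEnveloping.adjoin_range_ι (P : PMap F L p) (S : Module.Dual F L) :
    Algebra.adjoin F (Set.range (ReducedEnveloping.ι P S)) = ⊤ := by
  set A := Algebra.adjoin F (Set.range (ReducedEnveloping.ι P S)) with hA
  let g : L →ₗ⁅F⁆ A :=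
    { toFun := fun x => ⟨ReducedEnveloping.ι P S x, Algebra.subset_adjoin ⟨x, rfl⟩⟩
      map_add' := fun x y => Subtype.ext (by simp)
      map_smul' := fun c x => Subtype.ext (by simp)
      map_lie' := fun {x y} => Subtype.ext (by
        simp [LieRing.of_associative_ring_bracket]) }
  have hg : ∀ x, g x ^ p - g (P x) = algebraMap F A (S x ^ p) := fun x =>
    Subtype.ext (ReducedEnveloping.ι_pow_sub P S x)
  have h : A.val.comp (ReducedEnveloping.lift P S g hg) = AlgHom.id F _ :=
    ReducedEnveloping.hom_ext fun x => by
      rw [AlgHom.comp_apply, ReducedEnveloping.lift_ι]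
      rfl
  refine Algebra.eq_top_iff.mpr fun a => ?_
  have ha := AlgHom.congr_fun h a
  rw [AlgHom.comp_apply, AlgHom.id_apply] at ha
  rw [← ha]
  exact (ReducedEnveloping.lift P S g hg a).2

namespace Ind

variable [Fact p.Prime] [CharP F p] {P : PMap F L p} {S : Module.Dual F L}
  {H : LieSubalgebra F L} {hH : IsPSubalgebra P H}
  {M : Type*} [AddCommGroup M] [Module F M] [LieRingModule H M] [LieModule F H M]
  (hM : HasCharacter (P.restrict H hH) (restrictDual S H) M)

/-- The map `m ↦ 1 ⊗ m` from `M` to the induced module. -/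
noncomputable def of : M →ₗ[F] Ind hM :=
  ((balancedSubmodule hM).mkQ.restrictScalars F).comp
    (TensorProduct.mk F (ReducedEnveloping P S) M 1)

theorem of_apply (m : M) : of hM m = (balancedSubmodule hM).mkQ (1 ⊗ₜ[F] m) := rfl

theorem mkQ_tmul (a : ReducedEnveloping P S) (m : M) :
    (balancedSubmodule hM).mkQ (a ⊗ₜ[F] m) = a • of hM m := by
  rw [of_apply, ← map_smul, TensorProduct.smul_tmul', smul_eq_mul, mul_one]

theorem action_ι (h : H) (m : M) :
    hM.action (ReducedEnveloping.ι (P.restrict H hH) (restrictDual S H) h) m = ⁅h, m⁆ := by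
  rw [HasCharacter.action, ReducedEnveloping.lift_ι, LieModule.toEnd_apply_apply]

theorem incl_ι (h : H) : ReducedEnveloping.incl P S H hH
    (ReducedEnveloping.ι (P.restrict H hH) (restrictDual S H) h) = ReducedEnveloping.ι P S h :=
  ReducedEnveloping.lift_ι (P.restrict H hH) (restrictDual S H)
    ((ReducedEnveloping.ι P S).comp H.incl) _ h

theorem of_lie (h : H) (m : M) : of hM ⁅h, m⁆ = ⁅(h : L), of hM m⁆ := by
  have h1 : ((1 : ReducedEnveloping P S) * ReducedEnveloping.incl P S H hH
      (ReducedEnveloping.ι (P.restrict H hH) (restrictDual S H) h)) ⊗ₜ[F] m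
      - (1 : ReducedEnveloping P S) ⊗ₜ[F] (hM.action
        (ReducedEnveloping.ι (P.restrict H hH) (restrictDual S H) h) m)
      ∈ balancedSubmodule hM := Submodule.subset_span ⟨_, _, _, rfl⟩
  rw [action_ι, one_mul, incl_ι] at h1
  have h2 := (Submodule.Quotient.mk_eq_zero _).mpr h1
  rw [Submodule.Quotient.mk_sub, sub_eq_zero] at h2
  rw [Ind.lie_def, ← mkQ_tmul]
  exact h2.symm

theorem smul_mem (N : LieSubmodule F L (Ind hM)) (a : ReducedEnveloping P S) {v : Ind hM}
    (hv : v ∈ N) : a • v ∈ N := by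
  have ha : a ∈ Algebra.adjoin F (Set.range (ReducedEnveloping.ι P S)) := by
    rw [ReducedEnveloping.adjoin_range_ι]
    trivial
  induction ha using Algebra.adjoin_induction generalizing v with
  | mem x hx =>
    obtain ⟨y, rfl⟩ := hx
    exact N.lie_mem hv
  | algebraMap c =>
    rw [algebraMap_smul]
    exact N.smul_mem c hv
  | add x y _ _ hx hy =>
    rw [add_smul]
    exact N.add_mem (hx hv) (hy hv)
  | mul x y _ _ hx hy =>
    rw [mul_smul]
    exact hx (hy hv)

theorem eq_top_of_forall_of_mem (N : LieSubmodule F L (Ind hM)) (hN : ∀ m, of hM m ∈ N) :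
    N = ⊤ := by
  suffices h : ∀ v, v ∈ N from eq_top_iff.mpr fun v _ => h v
  intro v
  obtain ⟨t, rfl⟩ := (balancedSubmodule hM).mkQ_surjective v
  induction t using TensorProduct.induction_on with
  | zero =>
    rw [map_zero]
    exact N.zero_mem
  | tmul a m =>
    rw [mkQ_tmul]
    exact smul_mem hM N a (hN m)
  | add x y hx hy =>
    rw [map_add]
    exact N.add_mem hx hy

theorem defect_toEnd (x : L) : P.defect S (LieModule.toEnd F L (Ind hM)) x = 0 := by
  have hpow : ∀ n (v : Ind hM), (LieModule.toEnd F L (Ind hM) x ^ n) v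
      = ReducedEnveloping.ι P S x ^ n • v := by
    intro n v
    induction n with
    | zero => simp
    | succ n ih =>
      rw [pow_succ', pow_succ', Module.End.mul_apply, ih, mul_smul]
      rfl
  refine LinearMap.ext fun v => ?_
  have h : ReducedEnveloping.ι P S x ^ p • v - ReducedEnveloping.ι P S (P x) • v
      - S x ^ p • v = 0 := by
    rw [← sub_smul, ReducedEnveloping.ι_pow_sub, algebraMap_smul, sub_self]
  rw [← hpow, ← Ind.lie_def] at h
  simpa [PMap.defect, Algebra.algebraMap_eq_smul_one] using h

/-- The universal property of the induced module. -/
theorem exists_hom {W : Type*} [AddCommGroup W] [Module F W] (f : L →ₗ⁅F⁆ Module.End F W)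
    (hf : ∀ x, P.defect S f x = 0) (j : M →ₗ[F] W)
    (hj : ∀ (h : H) (m : M), j ⁅h, m⁆ = f (h : L) (j m)) :
    ∃ g : Ind hM →ₗ[F] W, (∀ m, g (of hM m) = j m) ∧ ∀ (x : L) v, g ⁅x, v⁆ = f x (g v) := by
  let φ : ReducedEnveloping P S →ₐ[F] Module.End F W :=
    ReducedEnveloping.lift P S f fun x => sub_eq_zero.mp (hf x)
  let ψ : ReducedEnveloping (P.restrict H hH) (restrictDual S H) →ₐ[F] Module.End F W :=
    φ.comp (ReducedEnveloping.incl P S H hH)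
  have hφ : ∀ x, φ (ReducedEnveloping.ι P S x) = f x := fun x => ReducedEnveloping.lift_ι P S f _ x
  have hψ : ∀ b m, ψ b (j m) = j (hM.action b m) := by
    intro b
    have hb : b ∈ Algebra.adjoin F
        (Set.range (ReducedEnveloping.ι (P.restrict H hH) (restrictDual S H))) := by
      rw [ReducedEnveloping.adjoin_range_ι]
      trivial
    induction hb using Algebra.adjoin_induction with
    | mem x hx =>
      obtain ⟨y, rfl⟩ := hx
      intro m
      rw [action_ι, hj, AlgHom.comp_apply, incl_ι, hφ]
    | algebraMap c =>
      intro m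
      simp [Algebra.algebraMap_eq_smul_one]
    | add x y _ _ hx hy =>
      intro m
      simp [hx, hy]
    | mul x y _ _ hx hy =>
      intro m
      rw [map_mul, map_mul, Module.End.mul_apply, Module.End.mul_apply, hy, hx]
  let g₀ : ReducedEnveloping P S ⊗[F] M →ₗ[F] W :=
    TensorProduct.lift ((LinearMap.lcomp F W j).comp φ.toLinearMap)
  have hg₀ : ∀ a m, g₀ (a ⊗ₜ m) = φ a (j m) := fun a m => rfl
  have hsmul : ∀ a t, g₀ (a • t) = φ a (g₀ t) := by
    intro a t
    induction t using TensorProduct.induction_on with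
    | zero => simp
    | tmul b m =>
      rw [TensorProduct.smul_tmul', hg₀, hg₀, smul_eq_mul, map_mul, Module.End.mul_apply]
    | add x y hx hy => rw [smul_add, map_add, hx, hy, map_add, map_add]
  have hker : (balancedSubmodule hM).restrictScalars F ≤ LinearMap.ker g₀ := by
    intro t ht
    rw [Submodule.restrictScalars_mem] at ht
    rw [LinearMap.mem_ker]
    induction ht using Submodule.span_induction with
    | mem t ht =>
      obtain ⟨a, b, m, rfl⟩ := ht
      rw [map_sub, hg₀, hg₀, map_mul, Module.End.mul_apply, ← hψ, sub_eq_zero]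
      rfl
    | zero => exact map_zero _
    | add x y _ _ hx hy => rw [map_add, hx, hy, add_zero]
    | smul a x _ hx => rw [hsmul, hx, map_zero]
  let g : Ind hM →ₗ[F] W := (((balancedSubmodule hM).restrictScalars F).liftQ g₀ hker).comp
    (Submodule.Quotient.restrictScalarsEquiv F (balancedSubmodule hM)).symm.toLinearMap
  have hg : ∀ t, g ((balancedSubmodule hM).mkQ t) = g₀ t := fun t => rfl
  refine ⟨g, fun m => ?_, fun x v => ?_⟩
  · rw [of_apply, hg, hg₀, map_one, Module.End.one_apply]
  · obtain ⟨t, rfl⟩ := (balancedSubmodule hM).mkQ_surjective v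
    rw [Ind.lie_def, ← map_smul, hg, hg, hsmul, hφ]

end Ind

end InducedMaps

/-! ### The ideal I acts by lowering degree. -/

section Irreducibility

attribute [local instance 100] LieRing.ofAssociativeRing

open Finsupp

variable {F L : Type*} [Field F] [LieRing L] [LieAlgebra F L] (I : LieIdeal F L)
  (lam : Module.Dual F I)

/-- The pairing `(y, x) ↦ λ([x, y])` of `I` and `L`. -/
noncomputable def stabilizerPairing : I →ₗ[F] Module.Dual F L :=
  LinearMap.mk₂ F (fun y x => lam ⁅x, y⁆) (fun y z x => by simp) (fun c y x => by simp)
    (fun y x z => by simp) (fun c y x => by simp)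

theorem exists_complBasis_lieStabilizer [FiniteDimensional F L] :
    ∃ (k : ℕ) (B : (lieStabilizer I lam).ComplBasis (Fin k)) (y : Fin k → I),
      ∀ i x, B.coord i x = lam ⁅x, y i⁆ := by
  let R : Submodule F (Module.Dual F L) := LinearMap.range (stabilizerPairing I lam)
  have : Module.Free F R := Module.Free.of_divisionRing F R
  let b := Module.finBasis F R
  have hy : ∀ i, ∃ y : I, stabilizerPairing I lam y = b i := fun i => (b i).2
  choose y hy using hy
  have he : ∀ j, ∃ e : L, ∀ i, (b i : Module.Dual F L) e = if i = j then 1 else 0 := by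
    intro j
    -- A coordinate form on R extends to the dual of L, and by reflexivity it is evaluation at a
    -- vector.
    obtain ⟨φ, hφ⟩ := LinearMap.exists_extend (b.coord j)
    refine ⟨(Module.evalEquiv F L).symm φ, fun i => ?_⟩
    rw [Module.apply_evalEquiv_symm_apply]
    have := LinearMap.congr_fun hφ (b i)
    rw [LinearMap.comp_apply] at this
    rw [Submodule.subtype_apply] at this
    rw [this, Module.Basis.coord_apply, Module.Basis.repr_self, Finsupp.single_apply]
  choose e he using he
  have hproj : ∀ x, x - ∑ i, (b i : Module.Dual F L) x • e i ∈ lieStabilizer I lam := by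
    intro x z
    have hz : ∀ r : R, (r : Module.Dual F L) (x - ∑ i, (b i : Module.Dual F L) x • e i) = 0 := by
      intro r
      rw [← b.sum_repr r]
      simp only [Submodule.coe_sum, Submodule.coe_smul, LinearMap.sum_apply, LinearMap.smul_apply]
      refine Finset.sum_eq_zero fun i _ => ?_
      simp [he]
    exact hz ⟨stabilizerPairing I lam z, z, rfl⟩
  refine ⟨_, ⟨e, fun i => b i, LinearMap.codRestrict (lieStabilizer I lam).toSubmodule
    (LinearMap.id - ∑ i, (b i : Module.Dual F L).smulRight (e i)) fun x => ?_, fun x => ?_,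
    fun i j => he j i, fun i h => ?_⟩, y, fun i x => ?_⟩
  · simpa using hproj x
  · change _ + (x - _) = x
    simp
  · rw [← hy]
    exact h.2 (y i)
  · change (b i : Module.Dual F L) x = _
    rw [← hy]
    rfl

variable {I lam} {ι M : Type*} [Fintype ι] [LinearOrder ι]
  (B : (lieStabilizer I lam).ComplBasis ι) [AddCommGroup M] [Module F M]
  [LieRingModule (lieStabilizer I lam) M] [LieModule F (lieStabilizer I lam) M]

namespace LieSubalgebra.ComplBasis

variable (M) in
/-- The operator `v ↦ y v - λ(y) v` on the induced module, for `y ∈ I`. -/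
noncomputable def shiftedRep (y : I) : Module.End F (Multiset ι →₀ M) :=
  B.rep M (y : L) - lam y • 1

theorem rep_eq_shiftedRep_add (y : I) (v : Multiset ι →₀ M) :
    B.rep M (y : L) v = B.shiftedRep M y v + lam y • v := by
  simp [shiftedRep]

theorem shiftedRep_single_zero
    (hI : ∀ y : I, ∃ h : lieStabilizer I lam, (h : L) = y ∧ ∀ m : M, ⁅h, m⁆ = lam y • m)
    (y : I) (m : M) : B.shiftedRep M y (single 0 m) = 0 := by
  obtain ⟨g, hg, hgm⟩ := hI y
  have h := B.act_coe_single_zero g m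
  rw [hgm, hg] at h
  simp [shiftedRep, rep_apply, h]

/-- Since I is an ideal, [e_i, y] is again in I, so the commutator splits into a degree-lowering
part and the scalar λ([e_i, y]). -/
theorem shiftedRep_single_cons (y : I) {i : ι} {t : Multiset ι} (ht : ∀ k ∈ t, i ≤ k) (m : M) :
    B.shiftedRep M y (single (i ::ₘ t) m)
      = B.rep M (B.vec i) (B.shiftedRep M y (single t m))
        - B.shiftedRep M ⁅B.vec i, y⁆ (single t m) - lam ⁅B.vec i, y⁆ • single t m := by
  have h1 := B.actsAsLie (y : L) (B.vec i) (single t m)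
  unfold ActsAsLie at h1
  have h2 := B.rep_eq_shiftedRep_add ⁅B.vec i, y⁆ (single t m)
  rw [B.act_vec_single ht, ← lie_skew, map_neg] at h1
  rw [LieSubmodule.coe_bracket, rep_apply] at h2
  rw [h2] at h1
  simp only [shiftedRep, LinearMap.sub_apply, LinearMap.smul_apply, Module.End.one_apply, map_sub,
    map_smul, rep_apply, B.act_vec_single ht] at h1 ⊢
  rw [h1]
  abel

theorem shiftedRep_single_mem
    (hI : ∀ y : I, ∃ h : lieStabilizer I lam, (h : L) = y ∧ ∀ m : M, ⁅h, m⁆ = lam y • m)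
    (y : I) (s : Multiset ι) (m : M) :
    B.shiftedRep M y (single s m) ∈ degreeLT F (Multiset.card s) := by
  generalize hn : Multiset.card s = n
  induction n generalizing s y with
  | zero =>
    rw [Multiset.card_eq_zero.mp hn, B.shiftedRep_single_zero hI]
    exact Submodule.zero_mem _
  | succ n ih =>
    obtain ⟨⟨i, t⟩, rfl, ht⟩ := s.exists_eq_cons_forall_le (by
      rintro rfl
      simp at hn)
    have hc : Multiset.card t = n := by simpa using hn
    rw [B.shiftedRep_single_cons y ht]
    exact Submodule.sub_mem _ (Submodule.sub_mem _ (B.rep_mem (ih y t hc) _)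
      (degreeLT_mono (Nat.le_succ n) (ih _ t hc)))
      (Submodule.smul_mem _ _ (single_mem_degreeLT (hc ▸ Nat.lt_succ_self _) m))

theorem shiftedRep_mem
    (hI : ∀ y : I, ∃ h : lieStabilizer I lam, (h : L) = y ∧ ∀ m : M, ⁅h, m⁆ = lam y • m)
    (y : I) {d : ℕ} {v : Multiset ι →₀ M} (hv : v ∈ degreeLT F (d + 1)) :
    B.shiftedRep M y v ∈ degreeLT F d :=
  map_mem_of_mem_degreeLT _ _ (fun s m hs =>
    degreeLT_mono (Nat.lt_succ_iff.mp hs) (B.shiftedRep_single_mem hI y s m)) hv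

/-- Modulo lower degree the operator is -∂/∂e_j: moving it past e_i contributes the scalar -λ([e_i,
y_j]) = -δ_ij. -/
theorem shiftedRep_single_add_mem
    (hI : ∀ y : I, ∃ h : lieStabilizer I lam, (h : L) = y ∧ ∀ m : M, ⁅h, m⁆ = lam y • m)
    {y : ι → I} (hy : ∀ i x, B.coord i x = lam ⁅x, y i⁆) (j : ι) (s : Multiset ι) (m : M) :
    B.shiftedRep M (y j) (single s m) + (s.count j : F) • single (s.erase j) m
      ∈ degreeLT F (Multiset.card s - 1) := by
  generalize hn : Multiset.card s = n
  induction n generalizing s with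
  | zero =>
    rw [Multiset.card_eq_zero.mp hn, B.shiftedRep_single_zero hI]
    simp
  | succ n ih =>
    obtain ⟨⟨i, t⟩, rfl, ht⟩ := s.exists_eq_cons_forall_le (by
      rintro rfl
      simp at hn)
    simp only at ht hn ⊢
    have hc : Multiset.card t = n := by simpa using hn
    have h1 := ih t hc
    have h2 : B.rep M (B.vec i)
        (B.shiftedRep M (y j) (single t m) + (t.count j : F) • single (t.erase j) m)
        ∈ degreeLT F n := by
      -- For n = 0 the bound n - 1 truncates to 0, so the inductive vector is zero.
      rcases n with _ | n
      · rw [eq_zero_of_mem_degreeLT_zero h1, map_zero]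
        exact Submodule.zero_mem _
      · exact B.rep_mem h1 _
    have h3 : B.shiftedRep M ⁅B.vec i, y j⁆ (single t m) ∈ degreeLT F n :=
      hc ▸ B.shiftedRep_single_mem hI _ t m
    have h4 : (((i ::ₘ t).count j : ℕ) : F) • single ((i ::ₘ t).erase j) m
        = (t.count j : F) • single (i ::ₘ t.erase j) m
          + lam ⁅B.vec i, y j⁆ • (single t m : Multiset ι →₀ M) := by
      rw [← hy, B.coord_vec]
      by_cases hij : j = i
      · subst hij
        rw [if_pos rfl, Multiset.count_cons_self, Multiset.erase_cons_head, Nat.cast_succ,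
          add_smul]
        by_cases hj : j ∈ t
        · rw [Multiset.cons_erase hj]
        · rw [Multiset.count_eq_zero_of_notMem hj]
          simp
      · rw [if_neg hij, Multiset.count_cons_of_ne hij,
          Multiset.erase_cons_tail _ (fun h => hij h.symm), zero_smul, add_zero]
    rw [Nat.add_sub_cancel, B.shiftedRep_single_cons _ ht, h4]
    have h5 : ∀ k ∈ t.erase j, i ≤ k := fun k hk => ht k (Multiset.mem_of_mem_erase hk)
    rw [map_add, map_smul, B.rep_apply _ (single (t.erase j) m), B.act_vec_single h5] at h2
    have h6 := Submodule.sub_mem _ h2 h3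
    convert h6 using 1
    abel

theorem shiftedRep_apply
    (hI : ∀ y : I, ∃ h : lieStabilizer I lam, (h : L) = y ∧ ∀ m : M, ⁅h, m⁆ = lam y • m)
    {y : ι → I} (hy : ∀ i x, B.coord i x = lam ⁅x, y i⁆) (j : ι) (u : Multiset ι)
    {v : Multiset ι →₀ M} (hv : v ∈ degreeLT F (Multiset.card u + 2)) :
    B.shiftedRep M (y j) v u = -((u.count j + 1 : ℕ) : F) • v (j ::ₘ u) := by
  refine map_eq_of_mem_degreeLT ((Finsupp.lapply u).comp (B.shiftedRep M (y j)))
    (-((u.count j + 1 : ℕ) : F) • Finsupp.lapply (j ::ₘ u)) (fun s m hs => ?_) hv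
  have h1 := apply_eq_zero_of_mem_degreeLT (B.shiftedRep_single_add_mem hI hy j s m)
    (s := u) (by omega)
  rw [Finsupp.add_apply, Finsupp.smul_apply] at h1
  rw [LinearMap.comp_apply, LinearMap.smul_apply, Finsupp.lapply_apply, Finsupp.lapply_apply,
    eq_neg_of_add_eq_zero_left h1, neg_smul]
  congr 1
  by_cases hj : j ∈ s
  · obtain ⟨t, rfl⟩ := Multiset.exists_cons_of_mem hj
    rw [Multiset.erase_cons_head]
    by_cases htu : t = u
    · subst htu
      simp
    · rw [Finsupp.single_eq_of_ne' htu, Finsupp.single_eq_of_ne' (by simpa using htu), smul_zero,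
        smul_zero]
  · have hne : s ≠ j ::ₘ u := by
      rintro rfl
      simp at hj
    rw [Multiset.count_eq_zero_of_notMem hj, Finsupp.single_eq_of_ne' hne]
    simp

/-- Strips the factors of a top-degree monomial s one at a time. Only the coefficient along s is
followed; the other monomials may have arbitrary exponents. -/
theorem exists_single_zero_mem {p : ℕ} [CharP F p]
    (hI : ∀ y : I, ∃ h : lieStabilizer I lam, (h : L) = y ∧ ∀ m : M, ⁅h, m⁆ = lam y • m)
    {y : ι → I} (hy : ∀ i x, B.coord i x = lam ⁅x, y i⁆) (N : Submodule F (Multiset ι →₀ M))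
    (hN : ∀ x, ∀ v ∈ N, B.rep M x v ∈ N) {v : Multiset ι →₀ M} (hvN : v ∈ N) {s : Multiset ι}
    (hvs : v s ≠ 0) (hv : v ∈ degreeLT F (Multiset.card s + 1)) (hs : ∀ i, s.count i < p) :
    ∃ m ≠ 0, single 0 m ∈ N := by
  generalize hn : Multiset.card s = n at hv
  induction n generalizing s v with
  | zero =>
    obtain rfl := Multiset.card_eq_zero.mp hn
    refine ⟨v 0, hvs, ?_⟩
    have : single 0 (v 0) = v := by
      ext t
      by_cases ht : t = 0
      · subst ht
        simp
      · rw [Finsupp.single_eq_of_ne ht]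
        refine (apply_eq_zero_of_mem_degreeLT hv ?_).symm
        have := Multiset.card_pos.mpr ht
        omega
    rwa [this]
  | succ n ih =>
    obtain ⟨j, hj⟩ := Multiset.card_pos_iff_exists_mem.mp (show 0 < Multiset.card s by omega)
    obtain ⟨u, rfl⟩ := Multiset.exists_cons_of_mem hj
    have hu : Multiset.card u = n := by simpa using hn
    refine ih (v := B.shiftedRep M (y j) v) (s := u) ?_ ?_ (fun i => ?_) hu
      (B.shiftedRep_mem hI _ hv)
    · exact N.sub_mem (hN _ v hvN) (N.smul_mem _ hvN)
    · rw [B.shiftedRep_apply hI hy j u (by rwa [hu])]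
      -- The factor is, up to sign, the exponent of j in the monomial, which lies between 1 and p -
      -- 1.
      refine smul_ne_zero (neg_ne_zero.mpr ?_) hvs
      have h1 := hs j
      rw [Multiset.count_cons_self] at h1
      rw [Ne, CharP.cast_eq_zero_iff F p]
      exact fun h => absurd (Nat.le_of_dvd (Nat.succ_pos _) h) (by omega)
    · exact lt_of_le_of_lt (Multiset.count_le_of_le i (Multiset.le_cons_self u j)) (hs i)

end LieSubalgebra.ComplBasis

end Irreducibility

/-! ### The two implications. -/

section Main

attribute [local instance 100] LieRing.ofAssociativeRing

open Finsupp

theorem HasCharacter.quotient {F L M : Type*} {p : ℕ} [Field F] [LieRing L] [LieAlgebra F L]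
    {P : PMap F L p} {S : Module.Dual F L} [AddCommGroup M] [Module F M] [LieRingModule L M]
    [LieModule F L M] (hM : HasCharacter P S M) (N : LieSubmodule F L M) :
    HasCharacter P S (M ⧸ N) := by
  intro x
  have hpow : ∀ (n : ℕ) (m : M), (LieModule.toEnd F L (M ⧸ N) x ^ n) (LieSubmodule.Quotient.mk m)
      = LieSubmodule.Quotient.mk ((LieModule.toEnd F L M x ^ n) m) := by
    intro n m
    induction n with
    | zero => rfl
    | succ n ih =>
      rw [pow_succ', pow_succ', Module.End.mul_apply, Module.End.mul_apply, ih]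
      rfl
  refine LinearMap.ext fun v => ?_
  obtain ⟨m, rfl⟩ := LieSubmodule.Quotient.surjective_mk' N v
  have h := congrArg (LieSubmodule.Quotient.mk' N) (LinearMap.congr_fun (hM x) m)
  simp only [LinearMap.sub_apply, LinearMap.smul_apply, Module.End.one_apply, map_sub,
    map_smul] at h ⊢
  rw [← h]
  congr 1
  exact hpow p m

namespace Ind

variable {F L : Type*} {p : ℕ} [Field F] [LieRing L] [LieAlgebra F L]
  [Fact p.Prime] [CharP F p] {P : PMap F L p} {S : Module.Dual F L}
  {H : LieSubalgebra F L} {hH : IsPSubalgebra P H} {ι : Type*} [Fintype ι] [LinearOrder ι]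
  {M : Type*} [AddCommGroup M] [Module F M] [LieRingModule H M] [LieModule F H M]
  (hM : HasCharacter (P.restrict H hH) (restrictDual S H) M)

theorem eq_zero_of_mem_lieSpan {W : Type*} [AddCommGroup W] [Module F W]
    (f : L →ₗ⁅F⁆ Module.End F W) (g : Ind hM →ₗ[F] W) (hg : ∀ (x : L) v, g ⁅x, v⁆ = f x (g v))
    {s : Set (Ind hM)} (hs : ∀ v ∈ s, g v = 0) {v : Ind hM}
    (hv : v ∈ LieSubmodule.lieSpan F L s) : g v = 0 := by
  let K : LieSubmodule F L (Ind hM) :=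
    { LinearMap.ker g with
      lie_mem := fun {x v} hv => by
        have hv' : g v = 0 := hv
        change g ⁅x, v⁆ = 0
        rw [hg, hv', map_zero] }
  have hle : LieSubmodule.lieSpan F L s ≤ K := LieSubmodule.lieSpan_le.mpr hs
  exact hle hv

/-- Any `H`-submodule of `M` is recovered from the `L`-submodule of the induced module that it
generates. -/
theorem mem_of_of_mem_lieSpan (B : H.ComplBasis ι) (N : LieSubmodule F H M) {m : M}
    (hm : of hM m ∈ LieSubmodule.lieSpan F L (of hM '' (N : Set M))) : m ∈ N := by
  have hMN := hM.quotient N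
  -- This map has kernel exactly N; its extension to the induced module kills all that N generates.
  let j : M →ₗ[F] (Multiset ι →₀ M ⧸ N) ⧸ B.relations (M ⧸ N) P S :=
    (B.relations (M ⧸ N) P S).mkQ.comp
      ((Finsupp.lsingle 0).comp (LieSubmodule.Quotient.mk' N : M →ₗ[F] M ⧸ N))
  have hjm : ∀ m, j m = (B.relations (M ⧸ N) P S).mkQ
      (single 0 (LieSubmodule.Quotient.mk' N m)) := fun m => rfl
  have hj : ∀ (h : H) (m : M), j ⁅h, m⁆ = B.redRep (M ⧸ N) P S (h : L) (j m) := by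
    intro h m
    rw [hjm, hjm, LieSubalgebra.ComplBasis.redRep_mk, LieSubalgebra.ComplBasis.rep_apply,
      LieSubalgebra.ComplBasis.act_coe_single_zero, LieModuleHom.map_lie]
  obtain ⟨g, hgj, hg⟩ := exists_hom hM (B.redRep (M ⧸ N) P S) (B.defect_redRep hMN) j hj
  have h0 : ∀ m, g (of hM m) = 0 → m ∈ N := by
    intro m hm
    rw [hgj, hjm, Submodule.mkQ_apply, Submodule.Quotient.mk_eq_zero] at hm
    have := B.eq_zero_of_single_zero_mem_relations P S hm
    exact (LieSubmodule.Quotient.mk_eq_zero').mp this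
  refine h0 m (eq_zero_of_mem_lieSpan hM _ g hg ?_ hm)
  rintro _ ⟨n, hn, rfl⟩
  have : LieSubmodule.Quotient.mk' N n = 0 := (LieSubmodule.Quotient.mk_eq_zero').mpr hn
  rw [hgj, hjm, this, single_zero, map_zero]

theorem of_injective (B : H.ComplBasis ι) : Function.Injective (of hM) := by
  rw [← LinearMap.ker_eq_bot, LinearMap.ker_eq_bot']
  intro m hm
  have h := mem_of_of_mem_lieSpan hM B ⊥ (m := m) (by
    rw [hm]
    exact LieSubmodule.zero_mem _)
  simpa using h

theorem isIrreducible_of_isIrreducible_ind (B : H.ComplBasis ι)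
    [LieModule.IsIrreducible F L (Ind hM)] :
    LieModule.IsIrreducible F H M := by
  have hnt : Nontrivial M := by
    by_contra hM'
    rw [not_nontrivial_iff_subsingleton] at hM'
    refine bot_ne_top (eq_top_of_forall_of_mem hM ⊥ fun m => ?_)
    rw [Subsingleton.elim m 0, map_zero]
    exact LieSubmodule.zero_mem _
  refine LieModule.IsIrreducible.mk fun N hN => ?_
  rw [Ne, LieSubmodule.eq_bot_iff] at hN
  push Not at hN
  obtain ⟨n, hn, hn0⟩ := hN
  have htop : LieSubmodule.lieSpan F L (of hM '' (N : Set M)) = ⊤ := by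
    refine (IsSimpleOrder.eq_bot_or_eq_top _).resolve_left fun h => hn0 ?_
    have h1 : of hM n ∈ LieSubmodule.lieSpan F L (of hM '' (N : Set M)) :=
      LieSubmodule.subset_lieSpan ⟨n, hn, rfl⟩
    rw [h, LieSubmodule.mem_bot] at h1
    exact of_injective hM B (h1.trans (map_zero _).symm)
  suffices h : ∀ m, m ∈ N from eq_top_iff.mpr fun m _ => h m
  intro m
  refine mem_of_of_mem_lieSpan hM B N ?_
  rw [htop]
  exact LieSubmodule.mem_top _

theorem extend_surjective (B : H.ComplBasis ι) :
    Function.Surjective (B.extend (LieModule.toEnd F L (Ind hM)) (of hM)) := by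
  let N : LieSubmodule F L (Ind hM) :=
    { LinearMap.range (B.extend (LieModule.toEnd F L (Ind hM)) (of hM)) with
      lie_mem := by
        rintro x _ ⟨v, rfl⟩
        exact ⟨B.rep M x v, B.extend_rep _ (of_lie hM) x v⟩ }
  have h := eq_top_of_forall_of_mem hM N fun m => ⟨single 0 m, B.extend_single_zero _ _ m⟩
  intro v
  have hv : v ∈ N := by
    rw [h]
    exact LieSubmodule.mem_top _
  exact hv

end Ind

/-- The descent takes place in the monomial model, on the preimage of W. Injectivity of the model
modulo relations into `Ind hM` is not required: a nonzero vector of W lifts to a vector that is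
nonzero and can be reduced to exponents below p. -/
theorem isIrreducible_ind_of_isIrreducible {F L M : Type*} {p : ℕ} [Fact p.Prime] [Field F]
    [CharP F p] [LieRing L] [LieAlgebra F L] {P : PMap F L p} {S : Module.Dual F L}
    {I : LieIdeal F L} {lam : Module.Dual F I} {ι : Type*} [Fintype ι] [LinearOrder ι]
    (B : (lieStabilizer I lam).ComplBasis ι) {y : ι → I}
    (hy : ∀ i x, B.coord i x = lam ⁅x, y i⁆) [AddCommGroup M] [Module F M]
    [LieRingModule (lieStabilizer I lam) M] [LieModule F (lieStabilizer I lam) M]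
    (hM : HasCharacter (P.restrict (lieStabilizer I lam) (isPSubalgebra_lieStabilizer I lam P))
      (restrictDual S (lieStabilizer I lam)) M)
    (hI : ∀ y : I, ∃ h : lieStabilizer I lam, (h : L) = y ∧ ∀ m : M, ⁅h, m⁆ = lam y • m)
    [LieModule.IsIrreducible F (lieStabilizer I lam) M] : LieModule.IsIrreducible F L (Ind hM) := by
  have hnt : Nontrivial M := LieModule.nontrivial_of_isIrreducible F (lieStabilizer I lam) M
  have hntI : Nontrivial (Ind hM) := (Ind.of_injective hM B).nontrivial
  refine LieModule.IsIrreducible.mk fun W hW => ?_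
  rw [Ne, LieSubmodule.eq_bot_iff] at hW
  push Not at hW
  obtain ⟨w, hw, hw0⟩ := hW
  obtain ⟨v, rfl⟩ := Ind.extend_surjective hM B w
  obtain ⟨v', hv', htr⟩ := B.exists_sub_mem_relations P S v
  have hvv := B.extend_relations _ (Ind.of_lie hM) (Ind.defect_toEnd hM) hv'
  rw [map_sub, sub_eq_zero] at hvv
  rw [hvv] at hw hw0
  have hne : v'.support.Nonempty := by
    rw [Finsupp.support_nonempty_iff]
    rintro rfl
    exact hw0 (map_zero _)
  obtain ⟨s, hs, hmax⟩ := v'.support.exists_max_image Multiset.card hne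
  obtain ⟨m, hm0, hm⟩ := B.exists_single_zero_mem (p := p) hI hy
    (W.toSubmodule.comap (B.extend (LieModule.toEnd F L (Ind hM)) (Ind.of hM)))
    (fun x v hv => by
      rw [Submodule.mem_comap, B.extend_rep _ (Ind.of_lie hM)]
      exact W.lie_mem hv)
    (v := v') hw (Finsupp.mem_support_iff.mp hs) (fun t ht => Nat.lt_succ_of_le (hmax t ht))
    (htr s (Finsupp.mem_support_iff.mp hs))
  rw [Submodule.mem_comap, B.extend_single_zero] at hm
  let N : LieSubmodule F (lieStabilizer I lam) M :=
    { W.toSubmodule.comap (Ind.of hM) with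
      lie_mem := fun {x n} hn => by
        change Ind.of hM ⁅x, n⁆ ∈ W
        rw [Ind.of_lie]
        exact W.lie_mem hn }
  have hN : N = ⊤ := by
    refine (IsSimpleOrder.eq_bot_or_eq_top N).resolve_left fun h => hm0 ?_
    have : m ∈ N := hm
    rwa [h, LieSubmodule.mem_bot] at this
  refine Ind.eq_top_of_forall_of_mem hM W fun n => ?_
  have : n ∈ N := by
    rw [hN]
    exact LieSubmodule.mem_top _
  exact this

end Main

theorem mainTheorem3 {F L M : Type*} {p : ℕ} [Fact p.Prime] [Field F] [CharP F p]
    [LieRing L] [LieAlgebra F L] [FiniteDimensional F L]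
    (P : PMap F L p) (S : Module.Dual F L)
    (I : LieIdeal F L) (lam : Module.Dual F I) (hlam : ∀ y z : I, lam ⁅y, z⁆ = 0)
    [AddCommGroup M] [Module F M] [FiniteDimensional F M]
    [LieRingModule (lieStabilizer I lam) M] [LieModule F (lieStabilizer I lam) M]
    (hM : HasCharacter (P.restrict (lieStabilizer I lam) (isPSubalgebra_lieStabilizer I lam P))
      (restrictDual S (lieStabilizer I lam)) M)
    (hI : ∀ (y : I) (m : M),
      ⁅(⟨(y : L), mem_lieStabilizer_of_mem I lam hlam y⟩ : lieStabilizer I lam), m⁆ = lam y • m) :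
    LieModule.IsIrreducible F L (Ind hM) ↔
      LieModule.IsIrreducible F (lieStabilizer I lam) M := by
  obtain ⟨k, B, y, hy⟩ := exists_complBasis_lieStabilizer I lam
  exact ⟨fun _ => Ind.isIrreducible_of_isIrreducible_ind hM B,
    fun _ => isIrreducible_ind_of_isIrreducible B hy hM fun y => ⟨_, rfl, hI y⟩⟩
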